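/- **Conventions.** Let $k$ be a field; algebras are associative unital $k$-algebras. Let $\mathcal A$ be a sheaf of algebras on a topological space (or a presheaf of algebras on a small category) and $\mathcal M$ an $\mathcal A$-bimodule, i.e. a sheaf (presheaf) of $\mathcal A\otimes_k\mathcal A^{o}$-modules. An *algebra extension* of $\mathcal A$ by $\mathcal M$ is an exact sequence of sheaves (presheaves) of $k$-modules $0\to\mathcal M\to\mathcal B\to\mathcal A\to0$ in which $\mathcal B$ is a sheaf (presheaf) of algebras, $\mathcal B\to\mathcal A$ is a homomorphism of algebras, and the $\mathcal B$-bimodule structure of the ideal $\mathcal M$ factors through $\mathcal A$ and is the given one. An isomorphism of extensions is an isomorphism of algebras $\mathcal B\cong\mathcal B'$ compatible with the maps from $\mathcal M$ and to $\mathcal A$. The isomorphism classes form a $k$-vector space $exal(\mathcal A,\mathcal M)$: addition is the Baer sum, $c\in k$ acts by pushout along $c:\mathcal M\to\mathcal M$, and zero is the class of the split extension $\mathcal A\oplus\mathcal M$. Let $k_1=k[t]/(t^2)$. Let $\operatorname{def}(\mathcal A)$ be the set of isomorphism classes of pairs $(\mathcal B,\theta)$, where $\mathcal B$ is a sheaf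 (presheaf) of $k_1$-algebras and $\theta:\operatorname{gr}\mathcal B\to\mathcal A\otimes_kk_1$ is an isomorphism of graded $k_1$-algebras, $\operatorname{gr}\mathcal B$ being the associated graded of the filtration $0\subset t\mathcal B\subset\mathcal B$. Sending $(\mathcal B,\theta)$ to $0\to t\mathcal B=\mathcal A\to\mathcal B\to\mathcal A\to0$ identifies $\operatorname{def}(\mathcal A)$ with $exal(\mathcal A,\mathcal A)$ and makes it a $k$-vector space. **Lemma 5.1.** Let $X$ be a scheme over $k$. Let $\mathcal A_X$ be a quasicoherent sheaf of algebras on $X$, i.e. a sheaf of $k$-algebras with a homomorphism of sheaves of unital $k$-algebras $\mathcal O_X\to\mathcal A_X$ (not necessarily central) that makes $\mathcal A_X$ a quasicoherent left $\mathcal O_X$-module. Let $\mathcal M_X$ be an $\mathcal A_X$-bimodule that is quasicoherent as a left $\mathcal O_X$-module. (For example, $X$ is quasiprojective and $(\mathcal A_X,\mathcal M_X)$ is an admissible pair of quasicoherent sheaves.) Let $\mathcal U$ be the category of affine open subsets of $X$ and inclusions, and for a sheaf $\mathcal F_X$ on $X$ let $\mathcal F_{\mathcal U}$ be the presheaf on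 $\mathcal U$ obtained by restriction. 1. For every algebra extension $0\to\mathcal M_X\to\mathcal B_X\to\mathcal A_X\to0$ the sequence of presheaves $0\to\mathcal M_{\mathcal U}\to\mathcal B_{\mathcal U}\to\mathcal A_{\mathcal U}\to0$ on $\mathcal U$ is exact, hence an algebra extension of $\mathcal A_{\mathcal U}$ by $\mathcal M_{\mathcal U}$, and $[\mathcal B_X]\mapsto[\mathcal B_{\mathcal U}]$ is a well-defined isomorphism of $k$-vector spaces $$exal(\mathcal A_X,\mathcal M_X)\xrightarrow{\ \sim\ }exal(\mathcal A_{\mathcal U},\mathcal M_{\mathcal U}).$$ 2. For every pair $(\mathcal B_X,\theta)$ defining an element of $\operatorname{def}(\mathcal A_X)$, the map $\mathcal B_X(U)\to\mathcal A_X(U)$ is surjective for each affine open $U$, so that $\mathcal B_{\mathcal U}$, with the restriction of $\theta$, defines an element of $\operatorname{def}(\mathcal A_{\mathcal U})$, and $[\mathcal B_X]\mapsto[\mathcal B_{\mathcal U}]$ is a well-defined isomorphism of $k$-vector spaces $\operatorname{def}(\mathcal A_X)\xrightarrow{\ \sim\ }\operatorname{def}(\mathcal A_{\mathcal U})$. 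-/

import Mathlib

open CategoryTheory Opposite
universe u
noncomputable section
namespace AlgExt

variable {k : Type u} [Field k] {C : Type u} [SmallCategory C] {J : GrothendieckTopology C}

/-! Everything below is done for sheaves on a site `(C, J)`. The two cases of interest are the open
subsets of a scheme with their usual topology, and a category with the trivial topology `⊥`, for
which every presheaf is a sheaf and "locally surjective" means surjective on all sections. -/

/-- A bimodule over a sheaf of `k`-algebras `A`, i.e. a left module over `A ⊗ₖ Aᵒᵖ`: a sheaf `sh` of
`k`-modules `M` with, for each `U`, a left action `lsmul` of the algebra `A(U)` and a right action
`rsmul` (a left action of the opposite algebra) on `M(U)` by `k`-linear maps, which commute with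
each other and are compatible with the restriction maps. -/
structure Bimod (A : Sheaf J (AlgCat.{u} k)) where
  sh : Sheaf J (ModuleCat.{u} k)
  lsmul : ∀ U : Cᵒᵖ, A.obj.obj U →ₐ[k] Module.End k (sh.obj.obj U)
  rsmul : ∀ U : Cᵒᵖ, (A.obj.obj U)ᵐᵒᵖ →ₐ[k] Module.End k (sh.obj.obj U)
  comm : ∀ (U : Cᵒᵖ) (a b : A.obj.obj U) (m : sh.obj.obj U),
    lsmul U a (rsmul U (.op b) m) = rsmul U (.op b) (lsmul U a m)
  map_lsmul : ∀ {U V : Cᵒᵖ} (f : U ⟶ V) (a : A.obj.obj U) (m : sh.obj.obj U),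
    sh.obj.map f (lsmul U a m) = lsmul V (A.obj.map f a) (sh.obj.map f m)
  map_rsmul : ∀ {U V : Cᵒᵖ} (f : U ⟶ V) (a : A.obj.obj U) (m : sh.obj.obj U),
    sh.obj.map f (rsmul U (.op a) m) = rsmul V (.op (A.obj.map f a)) (sh.obj.map f m)

/-- `A` as a bimodule over itself. -/
def Bimod.self (A : Sheaf J (AlgCat.{u} k)) : Bimod A where
  sh := (sheafCompose J (forget₂ (AlgCat.{u} k) (ModuleCat.{u} k))).obj A
  lsmul U := Algebra.lmul k (A.obj.obj U)
  rsmul U :=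
    { toFun := fun b => LinearMap.mulRight k b.unop
      map_one' := by ext x; exact mul_one (M := A.obj.obj U) x
      map_mul' := fun a b => by ext x; exact (mul_assoc (G := A.obj.obj U) x b.unop a.unop).symm
      map_zero' := by ext x; exact mul_zero (M₀ := A.obj.obj U) x
      map_add' := fun a b => by ext x; exact mul_add (R := A.obj.obj U) x a.unop b.unop
      commutes' := fun r => by
        ext x
        exact ((Algebra.commutes (A := A.obj.obj U) r x).symm).trans
          (Algebra.smul_def (A := A.obj.obj U) r x).symm }
  comm U a b m := (mul_assoc (G := A.obj.obj U) a m b).symm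
  map_lsmul {U V} f a m := map_mul (M := A.obj.obj U) (N := A.obj.obj V) (A.obj.map f).hom a m
  map_rsmul {U V} f a m := map_mul (M := A.obj.obj U) (N := A.obj.obj V) (A.obj.map f).hom m a

lemma map_apply {P Q : Cᵒᵖ ⥤ AlgCat.{u} k} (φ : P ⟶ Q) {U V : Cᵒᵖ} (f : U ⟶ V) (x : P.obj U) :
    φ.app V (P.map f x) = Q.map f (φ.app U x) := NatTrans.naturality_apply φ f x

/-- A family of subalgebras of `P(U) × Q(U)` that is stable under restriction. -/
structure PairFamily (P Q : Cᵒᵖ ⥤ AlgCat.{u} k) where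
  alg : ∀ U : Cᵒᵖ, Subalgebra k (P.obj U × Q.obj U)
  map_mem : ∀ {U V : Cᵒᵖ} (f : U ⟶ V) (p : P.obj U × Q.obj U), p ∈ alg U →
    (P.map f p.1, Q.map f p.2) ∈ alg V

namespace PairFamily
variable {P Q R : Cᵒᵖ ⥤ AlgCat.{u} k} (S : PairFamily P Q)

/-- The restriction maps. -/
def res {U V : Cᵒᵖ} (f : U ⟶ V) : S.alg U →ₐ[k] S.alg V :=
  ((AlgHom.prodMap (P.map f).hom (Q.map f).hom).comp (S.alg U).val).codRestrict
    (S.alg V) (fun p => S.map_mem f p.1 p.2)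

lemma res_id (U : Cᵒᵖ) (p : S.alg U) : S.res (𝟙 U) p = p := by
  refine Subtype.ext ?_
  change (P.map _ _, Q.map _ _) = _
  simp

lemma res_comp {U V W : Cᵒᵖ} (f : U ⟶ V) (g : V ⟶ W) (p : S.alg U) :
    S.res (f ≫ g) p = S.res g (S.res f p) := by
  refine Subtype.ext ?_
  change (P.map _ _, Q.map _ _) = (P.map _ (P.map _ _), Q.map _ (Q.map _ _))
  simp

/-- The associated presheaf of algebras. -/
def functor : Cᵒᵖ ⥤ AlgCat.{u} k where
  obj U := AlgCat.of k (S.alg U)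
  map f := AlgCat.ofHom (S.res f)
  map_id U := AlgCat.hom_ext _ (AlgHom.ext fun p => S.res_id U p)
  map_comp f g := AlgCat.hom_ext _ (AlgHom.ext fun p => S.res_comp f g p)

/-- The first projection. -/
def fst : S.functor ⟶ P where
  app U := AlgCat.ofHom ((AlgHom.fst k _ _).comp (S.alg U).val)
  naturality _ _ _ := rfl

/-- The second projection. -/
def snd : S.functor ⟶ Q where
  app U := AlgCat.ofHom ((AlgHom.snd k _ _).comp (S.alg U).val)
  naturality _ _ _ := rfl

/-- A pair of morphisms that takes values in the family. -/
def lift (φ : R ⟶ P) (ψ : R ⟶ Q) (h : ∀ U x, (φ.app U x, ψ.app U x) ∈ S.alg U) :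
    R ⟶ S.functor where
  app U := AlgCat.ofHom (((φ.app U).hom.prod (ψ.app U).hom).codRestrict (S.alg U) (h U))
  naturality U V f := by
    refine AlgCat.hom_ext _ (AlgHom.ext fun p => Subtype.ext ?_)
    change (φ.app V (R.map f p), ψ.app V (R.map f p)) =
      (P.map f (φ.app U p), Q.map f (ψ.app U p))
    rw [map_apply, map_apply]

end PairFamily

/-- The fibre product of presheaves of algebras. -/
def fib {P Q A : Cᵒᵖ ⥤ AlgCat.{u} k} (p : P ⟶ A) (q : Q ⟶ A) : PairFamily P Q where
  alg U := AlgHom.equalizer ((p.app U).hom.comp (AlgHom.fst k _ _))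
    ((q.app U).hom.comp (AlgHom.snd k _ _))
  map_mem {U V} f x hx := by
    change p.app V (P.map f x.1) = q.app V (Q.map f x.2)
    rw [map_apply, map_apply]
    exact congr(A.map f $hx)

/-- An algebra extension `0 → M → B → A → 0` of the sheaf of algebras `A` by the `A`-bimodule `M`.
Here `B` is a sheaf of unital associative `k`-algebras, `proj : B → A` is a homomorphism of sheaves
of unital algebras and `incl : M → B` is a homomorphism of sheaves of `k`-modules. The sequence is
exact as a sequence of sheaves: `incl` is injective, its image is the kernel of `proj` (for these
two it amounts to the same to ask for them on all sections), and `proj` is an epimorphism, i.e.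
locally surjective. By `mul_incl` and `incl_mul` the `B`-bimodule structure of the ideal `M` of `B`
factors through `proj` and is the given `A`-bimodule structure of `M`. -/
structure Extension (A : Sheaf J (AlgCat.{u} k)) (M : Bimod A) where
  B : Sheaf J (AlgCat.{u} k)
  proj : B.obj ⟶ A.obj
  incl : ∀ U : Cᵒᵖ, M.sh.obj.obj U →ₗ[k] B.obj.obj U
  incl_naturality : ∀ {U V : Cᵒᵖ} (f : U ⟶ V) (m : M.sh.obj.obj U),
    incl V (M.sh.obj.map f m) = B.obj.map f (incl U m)
  incl_injective : ∀ U, Function.Injective (incl U)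
  proj_eq_zero_iff : ∀ (U : Cᵒᵖ) (b : B.obj.obj U), proj.app U b = 0 ↔ ∃ m, incl U m = b
  proj_surjective : Presheaf.IsLocallySurjective J proj
  mul_incl : ∀ (U : Cᵒᵖ) (b : B.obj.obj U) (m : M.sh.obj.obj U),
    b * incl U m = incl U (M.lsmul U (proj.app U b) m)
  incl_mul : ∀ (U : Cᵒᵖ) (b : B.obj.obj U) (m : M.sh.obj.obj U),
    incl U m * b = incl U (M.rsmul U (.op (proj.app U b)) m)

namespace Extension
variable {A : Sheaf J (AlgCat.{u} k)} {M : Bimod A}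


/-- Isomorphism of extensions: an isomorphism of sheaves of algebras `B ≅ B'` that is compatible with
the projections to `A` and with the inclusions of `M`. -/
def Equivalent (E E' : Extension A M) : Prop :=
  ∃ α : E.B.obj ≅ E'.B.obj, α.hom ≫ E'.proj = E.proj ∧
    ∀ U m, α.hom.app U (E.incl U m) = E'.incl U m

lemma proj_incl (E : Extension A M) (U : Cᵒᵖ) (m : M.sh.obj.obj U) :
    E.proj.app U (E.incl U m) = 0 := (E.proj_eq_zero_iff U _).2 ⟨m, rfl⟩

lemma incl_mul_incl (E : Extension A M) (U : Cᵒᵖ) (m n : M.sh.obj.obj U) :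
    E.incl U m * E.incl U n = 0 := by
  rw [E.mul_incl, E.proj_incl, map_zero]; simp

lemma exists_of_proj_eq (E : Extension A M) {U : Cᵒᵖ} {b b' : E.B.obj.obj U}
    (h : E.proj.app U b = E.proj.app U b') : ∃ m, b' = b + E.incl U m := by
  obtain ⟨m, hm⟩ := (E.proj_eq_zero_iff U (b' - b)).1 (by rw [map_sub, h, sub_self])
  exact ⟨m, by rw [hm]; abel⟩

instance : IsEquiv (Extension A M) Equivalent where
  refl E := ⟨Iso.refl _, by simp, fun U m => rfl⟩
  symm E E' := by
    rintro ⟨α, h, h'⟩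
    refine ⟨α.symm, by simp [← h], fun U m => ?_⟩
    rw [← h' U m]
    change (α.hom.app U ≫ α.inv.app U) _ = _
    simp
  trans E E' E'' := by
    rintro ⟨α, h, h'⟩ ⟨β, g, g'⟩
    exact ⟨α ≪≫ β, by simp [h, g], fun U m => by simp [h', g']⟩

lemma equivalent_of_hom {E E' : Extension A M} (α : E.B.obj ⟶ E'.B.obj)
    (h : α ≫ E'.proj = E.proj) (h' : ∀ U m, α.app U (E.incl U m) = E'.incl U m) :
    Equivalent E E' := by
  have hp : ∀ U b, E'.proj.app U (α.app U b) = E.proj.app U b := fun U b => by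
    rw [← h]; rfl
  have inj : Presheaf.IsLocallyInjective J α := by
    refine Presheaf.isLocallyInjective_of_injective J α fun U => ?_
    refine (injective_iff_map_eq_zero (α.app U).hom).2 fun b hb => ?_
    have : E.proj.app U b = 0 := by
      rw [← hp]; erw [hb]; simp
    obtain ⟨m, rfl⟩ := (E.proj_eq_zero_iff U b).1 this
    have h2 : E'.incl U m = 0 := by rw [← h']; exact hb
    have h3 : m = 0 := E'.incl_injective U (by rw [h2, map_zero])
    rw [h3, map_zero]
  have surj : Presheaf.IsLocallySurjective J α := by
    constructor
    intro U y
    refine J.superset_covering ?_ (E.proj_surjective.imageSieve_mem (E'.proj.app (op U) y))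
    rintro V f ⟨b, hb⟩
    obtain ⟨m, hm⟩ := E'.exists_of_proj_eq (U := op V) (b := α.app _ b) (b' := E'.B.obj.map f.op y)
      (by rw [hp, hb, map_apply])
    refine ⟨b + E.incl _ m, ?_⟩
    rw [map_add, h', hm]
  let α' : E.B ⟶ E'.B := ⟨α⟩
  have : IsIso α' := (Sheaf.isLocallyBijective_iff_isIso α').1 ⟨inj, surj⟩
  have : IsIso α := inferInstanceAs (IsIso ((sheafToPresheaf J _).map α'))
  exact ⟨asIso α, h, h'⟩

/-- Comparison principle. -/
lemma equivalent_of_span {E E' : Extension A M} {P : Cᵒᵖ ⥤ AlgCat.{u} k}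
    (φ : P ⟶ E.B.obj) (φ' : P ⟶ E'.B.obj) (h : φ ≫ E.proj = φ' ≫ E'.proj)
    (hs : Presheaf.IsLocallySurjective J (φ ≫ E.proj))
    (hk : ∀ U x, E.proj.app U (φ.app U x) = 0 →
      ∃ m, φ.app U x = E.incl U m ∧ φ'.app U x = E'.incl U m) :
    Equivalent E E' := by
  have hp : ∀ U x, E.proj.app U (φ.app U x) = E'.proj.app U (φ'.app U x) := fun U x =>
    congr($(h).app U x)
  let S (U : Cᵒᵖ) : Subalgebra k (E.B.obj.obj U × E'.B.obj.obj U) :=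
    { carrier := {p | ∃ x m, p = (φ.app U x + E.incl U m, φ'.app U x + E'.incl U m)}
      mul_mem' := by
        rintro _ _ ⟨x, m, rfl⟩ ⟨y, n, rfl⟩
        refine ⟨x * y, M.lsmul U (E.proj.app U (φ.app U x)) n
          + M.rsmul U (.op (E.proj.app U (φ.app U y))) m, ?_⟩
        simp only [Prod.mk_mul_mk, mul_add, add_mul, incl_mul_incl, map_mul, map_add, add_zero]
        rw [E.mul_incl, E'.mul_incl, E.incl_mul, E'.incl_mul, hp, hp]
        ext <;> simp only <;> abel
      add_mem' := by
        rintro _ _ ⟨x, m, rfl⟩ ⟨y, n, rfl⟩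
        refine ⟨x + y, m + n, ?_⟩
        simp only [Prod.mk_add_mk, map_add]
        ext <;> simp only <;> abel
      algebraMap_mem' := fun r => ⟨algebraMap k _ r, 0, by
        simp only [map_zero, add_zero]
        ext
        · exact ((φ.app U).hom.commutes r).symm
        · exact ((φ'.app U).hom.commutes r).symm⟩ }
  let T : PairFamily E.B.obj E'.B.obj := ⟨S, by
    rintro U V f _ ⟨x, m, rfl⟩
    refine ⟨P.map f x, M.sh.obj.map f m, ?_⟩
    simp only [map_apply, incl_naturality, map_add]⟩
  let fst := T.fst
  let snd := T.snd
  have inj : Presheaf.IsLocallyInjective J fst := by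
    refine Presheaf.isLocallyInjective_of_injective J fst fun U => ?_
    refine (injective_iff_map_eq_zero (fst.app U).hom).2 ?_
    rintro ⟨_, x, m, rfl⟩ hb
    change φ.app U x + E.incl U m = 0 at hb
    have h0 : E.proj.app U (φ.app U x) = 0 := by
      have := congr(E.proj.app U $hb)
      rwa [map_add, map_zero, proj_incl, add_zero] at this
    obtain ⟨n, hn, hn'⟩ := hk U x h0
    have h3 : n + m = 0 := E.incl_injective U (by rw [map_add, ← hn, hb, map_zero])
    apply Subtype.ext
    change (_, _) = (0, 0)
    rw [hb, hn', ← map_add, h3, map_zero]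
  have surj : Presheaf.IsLocallySurjective J fst := by
    constructor
    intro U y
    refine J.superset_covering ?_ (hs.imageSieve_mem (E.proj.app (op U) y))
    rintro V f ⟨b, hb⟩
    obtain ⟨m, hm⟩ := E.exists_of_proj_eq (U := op V) (b := φ.app _ b) (b' := E.B.obj.map f.op y)
      (by rw [map_apply]; exact hb)
    exact ⟨⟨_, b, m, rfl⟩, hm.symm⟩
  have W : J.W fst := J.W_of_isLocallyBijective fst
  obtain ⟨α, hα⟩ := (W _ E'.B.property).2 snd
  have hα' : ∀ U p, α.app U (fst.app U p) = snd.app U p := fun U p => congr($(hα).app U p)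
  refine equivalent_of_hom α ?_ fun U m => ?_
  · apply (W _ A.property).1
    dsimp only at hα ⊢
    rw [← Category.assoc, hα]
    ext U ⟨_, x, m, rfl⟩
    change E'.proj.app U (φ'.app U x + E'.incl U m) = E.proj.app U (φ.app U x + E.incl U m)
    rw [map_add, map_add, proj_incl, proj_incl, hp]
  · have := hα' U ⟨(E.incl U m, E'.incl U m), 0, m, by simp⟩
    exact this


/-! ### The Baer sum -/

/-- The antidiagonal copy `{(m, -m)}` of `M` in `B₁ ×_A B₂`. -/
def antidiag (E₁ E₂ : Extension A M) (U : Cᵒᵖ) : Ideal ((fib E₁.proj E₂.proj).alg U) where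
  carrier := {d | ∃ m, d.1 = (E₁.incl U m, -E₂.incl U m)}
  add_mem' := by
    rintro ⟨_, h⟩ ⟨_, h'⟩ ⟨m, rfl⟩ ⟨n, rfl⟩
    refine ⟨m + n, ?_⟩
    change (_ + _, _ + _) = _
    rw [map_add, map_add, neg_add]
  zero_mem' := ⟨0, by rw [map_zero, map_zero, neg_zero]; rfl⟩
  smul_mem' := by
    rintro ⟨⟨b, b'⟩, hb⟩ ⟨_, h⟩ ⟨m, rfl⟩
    have hb' : E₁.proj.app U b = E₂.proj.app U b' := hb
    refine ⟨M.lsmul U (E₁.proj.app U b) m, ?_⟩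
    change (b * _, b' * _) = _
    rw [E₁.mul_incl, mul_neg, E₂.mul_incl, hb']

instance (E₁ E₂ : Extension A M) (U : Cᵒᵖ) : (antidiag E₁ E₂ U).IsTwoSided where
  mul_mem_of_left := by
    rintro ⟨_, h⟩ ⟨⟨b, b'⟩, hb⟩ ⟨m, rfl⟩
    have hb' : E₁.proj.app U b = E₂.proj.app U b' := hb
    refine ⟨M.rsmul U (.op (E₁.proj.app U b)) m, ?_⟩
    change (_ * b, _ * b') = _
    rw [E₁.incl_mul, neg_mul, E₂.incl_mul, hb']

/-- The presheaf `U ↦ (B₁(U) ×_{A(U)} B₂(U)) / {(m, -m)}`. -/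
def sumPresheaf (E₁ E₂ : Extension A M) : Cᵒᵖ ⥤ AlgCat.{u} k where
  obj U := AlgCat.of k ((fib E₁.proj E₂.proj).alg U ⧸ antidiag E₁ E₂ U)
  map {U V} f := AlgCat.ofHom
    (Ideal.quotientMapₐ (antidiag E₁ E₂ V) ((fib E₁.proj E₂.proj).res f) (by
      rintro ⟨_, h⟩ ⟨m, rfl⟩
      refine ⟨M.sh.obj.map f m, ?_⟩
      change (E₁.B.obj.map f (E₁.incl U m), E₂.B.obj.map f (-E₂.incl U m)) = _
      rw [map_neg, incl_naturality, incl_naturality]))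
  map_id U := by
    refine AlgCat.hom_ext _ (AlgHom.ext fun p => ?_)
    obtain ⟨p, rfl⟩ := Ideal.Quotient.mk_surjective p
    exact congrArg (Ideal.Quotient.mk _) ((fib E₁.proj E₂.proj).res_id U p)
  map_comp {U V W} f g := by
    refine AlgCat.hom_ext _ (AlgHom.ext fun p => ?_)
    obtain ⟨p, rfl⟩ := Ideal.Quotient.mk_surjective p
    exact congrArg (Ideal.Quotient.mk _) ((fib E₁.proj E₂.proj).res_comp f g p)

/-- The quotient map. -/
def toSumPresheaf (E₁ E₂ : Extension A M) :
    (fib E₁.proj E₂.proj).functor ⟶ sumPresheaf E₁ E₂ where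
  app U := AlgCat.ofHom (Ideal.Quotient.mkₐ k (antidiag E₁ E₂ U))
  naturality _ _ _ := rfl

/-- The projection to `A`. -/
def sumPresheafProj (E₁ E₂ : Extension A M) : sumPresheaf E₁ E₂ ⟶ A.obj where
  app U := AlgCat.ofHom (Ideal.Quotient.liftₐ (antidiag E₁ E₂ U)
    ((fib E₁.proj E₂.proj).fst.app U ≫ E₁.proj.app U).hom (by
      rintro ⟨_, h⟩ ⟨m, rfl⟩
      exact E₁.proj_incl U m))
  naturality _ _ f := by
    refine AlgCat.hom_ext _ (AlgHom.ext fun p => ?_)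
    obtain ⟨p, rfl⟩ := Ideal.Quotient.mk_surjective p
    exact map_apply E₁.proj f p.1.1

lemma mem_fib (E₁ E₂ : Extension A M) (U : Cᵒᵖ) (m n : M.sh.obj.obj U) :
    (E₁.incl U m, E₂.incl U n) ∈ (fib E₁.proj E₂.proj).alg U := by
  change E₁.proj.app U (E₁.incl U m) = E₂.proj.app U (E₂.incl U n)
  rw [proj_incl, proj_incl]

/-- The inclusion of `M`, given by `m ↦ (m, 0)`. -/
def sumPresheafIncl (E₁ E₂ : Extension A M) (U : Cᵒᵖ) :
    M.sh.obj.obj U →ₗ[k] (sumPresheaf E₁ E₂).obj U :=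
  (Ideal.Quotient.mkₐ k (antidiag E₁ E₂ U)).toLinearMap ∘ₗ
    LinearMap.codRestrict ((fib E₁.proj E₂.proj).alg U).toSubmodule
      ((E₁.incl U).prod (0 : _ →ₗ[k] E₂.B.obj.obj U)) (fun m => by
        have := mem_fib E₁ E₂ U m 0
        rwa [map_zero] at this)

lemma sumPresheafIncl_add (E₁ E₂ : Extension A M) (U : Cᵒᵖ) (m n : M.sh.obj.obj U) :
    (toSumPresheaf E₁ E₂).app U ⟨(E₁.incl U m, E₂.incl U n), mem_fib E₁ E₂ U m n⟩ =
      sumPresheafIncl E₁ E₂ U (m + n) := by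
  refine (Ideal.Quotient.eq (I := antidiag E₁ E₂ U)).2 ⟨-n, ?_⟩
  change (_ - E₁.incl U (m + n), _ - 0) = _
  simp

lemma sumPresheafIncl_injective (E₁ E₂ : Extension A M) (U : Cᵒᵖ) :
    Function.Injective (sumPresheafIncl E₁ E₂ U) := by
  refine (injective_iff_map_eq_zero (sumPresheafIncl E₁ E₂ U)).2 fun m hm => ?_
  obtain ⟨n, hn⟩ := Ideal.Quotient.eq_zero_iff_mem.1 hm
  have h1 : E₁.incl U m = E₁.incl U n := congr($(hn).1)
  have h2 : 0 = - E₂.incl U n := congr($(hn).2)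
  rw [E₁.incl_injective U h1]
  apply E₂.incl_injective U
  rw [map_zero]; exact neg_eq_zero.1 h2.symm

lemma sumPresheafProj_eq_zero (E₁ E₂ : Extension A M) (U : Cᵒᵖ) (x : (sumPresheaf E₁ E₂).obj U)
    (hx : (sumPresheafProj E₁ E₂).app U x = 0) : ∃ m, sumPresheafIncl E₁ E₂ U m = x := by
  obtain ⟨⟨⟨b, b'⟩, h⟩, rfl⟩ := Ideal.Quotient.mk_surjective x
  obtain ⟨m, rfl⟩ := (E₁.proj_eq_zero_iff U b).1 hx
  obtain ⟨n, rfl⟩ := (E₂.proj_eq_zero_iff U b').1 (by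
    have h' : E₁.proj.app U (E₁.incl U m) = E₂.proj.app U b' := h
    rw [← h', proj_incl])
  exact ⟨m + n, (sumPresheafIncl_add E₁ E₂ U m n).symm⟩

lemma sumPresheafIncl_naturality (E₁ E₂ : Extension A M) {U V : Cᵒᵖ} (f : U ⟶ V)
    (m : M.sh.obj.obj U) : sumPresheafIncl E₁ E₂ V (M.sh.obj.map f m) =
      (sumPresheaf E₁ E₂).map f (sumPresheafIncl E₁ E₂ U m) := by
  change Ideal.Quotient.mk (antidiag E₁ E₂ V) _ = Ideal.Quotient.mk (antidiag E₁ E₂ V) _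
  congr 1
  apply Subtype.ext
  change (E₁.incl V (M.sh.obj.map f m), (0 : E₂.B.obj.obj V)) =
    (E₁.B.obj.map f (E₁.incl U m), E₂.B.obj.map f (0 : E₂.B.obj.obj U))
  rw [incl_naturality, map_zero]

lemma mul_sumPresheafIncl (E₁ E₂ : Extension A M) (U : Cᵒᵖ) (x : (sumPresheaf E₁ E₂).obj U)
    (m : M.sh.obj.obj U) : x * sumPresheafIncl E₁ E₂ U m =
      sumPresheafIncl E₁ E₂ U (M.lsmul U ((sumPresheafProj E₁ E₂).app U x) m) := by
  obtain ⟨⟨⟨b, b'⟩, h⟩, rfl⟩ := Ideal.Quotient.mk_surjective x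
  change Ideal.Quotient.mk (antidiag E₁ E₂ U) (_ * _) = Ideal.Quotient.mk (antidiag E₁ E₂ U) _
  congr 1
  apply Subtype.ext
  change (b * E₁.incl U m, b' * 0) = (E₁.incl U _, 0)
  rw [mul_incl, mul_zero]; rfl

lemma sumPresheafIncl_mul (E₁ E₂ : Extension A M) (U : Cᵒᵖ) (x : (sumPresheaf E₁ E₂).obj U)
    (m : M.sh.obj.obj U) : sumPresheafIncl E₁ E₂ U m * x =
      sumPresheafIncl E₁ E₂ U (M.rsmul U (.op ((sumPresheafProj E₁ E₂).app U x)) m) := by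
  obtain ⟨⟨⟨b, b'⟩, h⟩, rfl⟩ := Ideal.Quotient.mk_surjective x
  change Ideal.Quotient.mk (antidiag E₁ E₂ U) (_ * _) = Ideal.Quotient.mk (antidiag E₁ E₂ U) _
  congr 1
  apply Subtype.ext
  change (E₁.incl U m * b, 0 * b') = (E₁.incl U _, 0)
  rw [incl_mul, zero_mul]; rfl


lemma alg_ext (F : Sheaf J (AlgCat.{u} k)) {U : Cᵒᵖ} (S : Sieve U.unop) (hS : S ∈ J U.unop)
    (x y : F.obj.obj U) (h : ∀ ⦃V : C⦄ (f : V ⟶ U.unop), S f →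
      F.obj.map f.op x = F.obj.map f.op y) : x = y :=
  (((isSheaf_iff_isSheaf_of_type J _).1
    ((sheafCompose J (forget (AlgCat.{u} k))).obj F).property).isSeparated S hS).ext
      fun _ f hf => h f hf

lemma mod_ext (F : Sheaf J (ModuleCat.{u} k)) {U : Cᵒᵖ} (S : Sieve U.unop) (hS : S ∈ J U.unop)
    (x y : F.obj.obj U) (h : ∀ ⦃V : C⦄ (f : V ⟶ U.unop), S f →
      F.obj.map f.op x = F.obj.map f.op y) : x = y :=
  (((isSheaf_iff_isSheaf_of_type J _).1
    ((sheafCompose J (forget (ModuleCat.{u} k))).obj F).property).isSeparated S hS).ext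
      fun _ f hf => h f hf

/-- If a section of `B` locally comes from `M` along an injective natural map, it comes from `M`. -/
lemma exists_glue (F : Sheaf J (ModuleCat.{u} k)) (B : Sheaf J (AlgCat.{u} k))
    (i : ∀ U : Cᵒᵖ, F.obj.obj U →ₗ[k] B.obj.obj U)
    (nat : ∀ {U V : Cᵒᵖ} (f : U ⟶ V) (m : F.obj.obj U),
      i V (F.obj.map f m) = B.obj.map f (i U m))
    (inj : ∀ U, Function.Injective (i U)) {U : Cᵒᵖ} (S : Sieve U.unop) (hS : S ∈ J U.unop)
    (b : B.obj.obj U) (h : ∀ ⦃V : C⦄ (f : V ⟶ U.unop), S f → ∃ m, i (op V) m = B.obj.map f.op b) :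
    ∃ m, i U m = b := by
  choose m hm using h
  have hF := ((isSheaf_iff_isSheaf_of_type J _).1
    ((sheafCompose J (forget (ModuleCat.{u} k))).obj F).property) S hS
  obtain ⟨t, ht, -⟩ := hF (fun V f hf => m f hf) (by
    intro V₁ V₂ W g₁ g₂ f₁ f₂ h₁ h₂ e
    apply inj
    refine (nat g₁.op _).trans (Eq.trans ?_ (nat g₂.op _).symm)
    rw [hm, hm, ← ConcreteCategory.comp_apply, ← ConcreteCategory.comp_apply, ← Functor.map_comp,
      ← Functor.map_comp, ← op_comp, ← op_comp, e])
  refine ⟨t, alg_ext B S hS _ _ fun V f hf => ?_⟩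
  exact (nat f.op _).symm.trans ((congrArg _ (ht f hf)).trans (hm f hf))

/-- The underlying sheaf of algebras of the Baer sum: the sheafification of
`U ↦ (B₁(U) ×_{A(U)} B₂(U)) / {(m, -m)}`. -/
def sumSheaf (E₁ E₂ : Extension A M) : Sheaf J (AlgCat.{u} k) :=
  (presheafToSheaf J (AlgCat.{u} k)).obj (sumPresheaf E₁ E₂)

/-- The canonical map to the sheafification. -/
def toSumSheaf (E₁ E₂ : Extension A M) : sumPresheaf E₁ E₂ ⟶ (sumSheaf E₁ E₂).obj :=
  toSheafify J (sumPresheaf E₁ E₂)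

lemma W_toSumSheaf (E₁ E₂ : Extension A M) : J.W (toSumSheaf E₁ E₂) :=
  J.W_toSheafify (sumPresheaf E₁ E₂)

/-- The projection of the Baer sum to `A`. -/
def sumProj (E₁ E₂ : Extension A M) : (sumSheaf E₁ E₂).obj ⟶ A.obj :=
  sheafifyLift J (sumPresheafProj E₁ E₂) A.property

lemma sumProj_apply (E₁ E₂ : Extension A M) (U : Cᵒᵖ) (x : (sumPresheaf E₁ E₂).obj U) :
    (sumProj E₁ E₂).app U ((toSumSheaf E₁ E₂).app U x) = (sumPresheafProj E₁ E₂).app U x :=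
  congr($(toSheafify_sheafifyLift J (sumPresheafProj E₁ E₂) A.property).app U x)

/-- The inclusion of `M` in the Baer sum. -/
def sumIncl (E₁ E₂ : Extension A M) (U : Cᵒᵖ) : M.sh.obj.obj U →ₗ[k] (sumSheaf E₁ E₂).obj.obj U :=
  ((toSumSheaf E₁ E₂).app U).hom.toLinearMap ∘ₗ sumPresheafIncl E₁ E₂ U

lemma sumIncl_apply (E₁ E₂ : Extension A M) (U : Cᵒᵖ) (m : M.sh.obj.obj U) :
    sumIncl E₁ E₂ U m = (toSumSheaf E₁ E₂).app U (sumPresheafIncl E₁ E₂ U m) := rfl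

lemma sumIncl_naturality (E₁ E₂ : Extension A M) {U V : Cᵒᵖ} (f : U ⟶ V)
    (m : M.sh.obj.obj U) : sumIncl E₁ E₂ V (M.sh.obj.map f m) =
      (sumSheaf E₁ E₂).obj.map f (sumIncl E₁ E₂ U m) := by
  rw [sumIncl_apply, sumIncl_apply, sumPresheafIncl_naturality, map_apply]

lemma sumIncl_injective (E₁ E₂ : Extension A M) (U : Cᵒᵖ) :
    Function.Injective (sumIncl E₁ E₂ U) := by
  intro m n h
  have := (W_toSumSheaf E₁ E₂).isLocallyInjective
  refine mod_ext M.sh _ (Presheaf.equalizerSieve_mem J (toSumSheaf E₁ E₂) _ _ h) _ _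
    fun V f hf => sumPresheafIncl_injective E₁ E₂ _ ?_
  rw [sumPresheafIncl_naturality, sumPresheafIncl_naturality]
  exact hf

lemma sumProj_eq_zero_iff (E₁ E₂ : Extension A M) (U : Cᵒᵖ) (b : (sumSheaf E₁ E₂).obj.obj U) :
    (sumProj E₁ E₂).app U b = 0 ↔ ∃ m, sumIncl E₁ E₂ U m = b := by
  constructor
  · intro h
    have := (W_toSumSheaf E₁ E₂).isLocallySurjective
    refine exists_glue M.sh (sumSheaf E₁ E₂) (sumIncl E₁ E₂) (sumIncl_naturality E₁ E₂)
      (sumIncl_injective E₁ E₂) _ (Presheaf.imageSieve_mem J (toSumSheaf E₁ E₂) b) b ?_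
    rintro V f ⟨t, ht⟩
    obtain ⟨m, rfl⟩ := sumPresheafProj_eq_zero E₁ E₂ _ t (by
      rw [← sumProj_apply, ht]
      refine (map_apply (sumProj E₁ E₂) f.op b).trans ?_
      rw [h, map_zero])
    exact ⟨m, ht⟩
  · rintro ⟨m, rfl⟩
    rw [sumIncl_apply, sumProj_apply]
    exact E₁.proj_incl U m

/-- The Baer sum `(B₁ ×_A B₂) / {(m, -m)}` of two extensions. -/
def sum (E₁ E₂ : Extension A M) : Extension A M where
  B := sumSheaf E₁ E₂
  proj := sumProj E₁ E₂
  incl := sumIncl E₁ E₂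
  incl_naturality := sumIncl_naturality E₁ E₂
  incl_injective := sumIncl_injective E₁ E₂
  proj_eq_zero_iff := sumProj_eq_zero_iff E₁ E₂
  proj_surjective := by
    have : Presheaf.IsLocallySurjective J (toSumSheaf E₁ E₂ ≫ sumProj E₁ E₂) := by
      constructor
      intro U a
      refine J.superset_covering ?_ (J.intersection_covering
        (E₁.proj_surjective.imageSieve_mem a) (E₂.proj_surjective.imageSieve_mem a))
      rintro V f ⟨⟨b, hb⟩, ⟨b', hb'⟩⟩
      exact ⟨(toSumPresheaf E₁ E₂).app _ ⟨(b, b'), hb.trans hb'.symm⟩,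
        (sumProj_apply E₁ E₂ _ _).trans hb⟩
    exact Presheaf.isLocallySurjective_of_isLocallySurjective J (toSumSheaf E₁ E₂) _
  mul_incl U b m := by
    have := (W_toSumSheaf E₁ E₂).isLocallySurjective
    refine alg_ext (sumSheaf E₁ E₂) _ (Presheaf.imageSieve_mem J (toSumSheaf E₁ E₂) b) _ _ ?_
    rintro V f ⟨t, ht⟩
    rw [map_mul, ← sumIncl_naturality, ← sumIncl_naturality, M.map_lsmul, ← map_apply, ← ht,
      sumProj_apply, sumIncl_apply, sumIncl_apply, ← mul_sumPresheafIncl, map_mul]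
  incl_mul U b m := by
    have := (W_toSumSheaf E₁ E₂).isLocallySurjective
    refine alg_ext (sumSheaf E₁ E₂) _ (Presheaf.imageSieve_mem J (toSumSheaf E₁ E₂) b) _ _ ?_
    rintro V f ⟨t, ht⟩
    rw [map_mul, ← sumIncl_naturality, ← sumIncl_naturality, M.map_rsmul, ← map_apply, ← ht,
      sumProj_apply, sumIncl_apply, sumIncl_apply, ← sumPresheafIncl_mul, map_mul]


/-! ### The split extension -/

variable (A M) in
/-- The underlying type `A(U) ⊕ M(U)` of the sections of the split extension. -/
@[ext]
structure SplitObj (U : Cᵒᵖ) : Type u where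
  left : A.obj.obj U
  right : M.sh.obj.obj U

namespace SplitObj
variable {U : Cᵒᵖ}

instance : Zero (SplitObj A M U) := ⟨⟨0, 0⟩⟩
instance : One (SplitObj A M U) := ⟨⟨1, 0⟩⟩
instance : Add (SplitObj A M U) := ⟨fun x y => ⟨x.left + y.left, x.right + y.right⟩⟩
instance : Neg (SplitObj A M U) := ⟨fun x => ⟨-x.left, -x.right⟩⟩
instance : SMul k (SplitObj A M U) := ⟨fun c x => ⟨c • x.left, c • x.right⟩⟩

/-- The multiplication `(a, m) (a', m') = (a a', a m' + m a')`. -/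
instance : Mul (SplitObj A M U) :=
  ⟨fun x y => ⟨x.left * y.left, M.lsmul U x.left y.right + M.rsmul U (.op y.left) x.right⟩⟩

@[simp] lemma zero_left : (0 : SplitObj A M U).left = 0 := rfl
@[simp] lemma zero_right : (0 : SplitObj A M U).right = 0 := rfl
@[simp] lemma one_left : (1 : SplitObj A M U).left = 1 := rfl
@[simp] lemma one_right : (1 : SplitObj A M U).right = 0 := rfl
@[simp] lemma add_left (x y : SplitObj A M U) : (x + y).left = x.left + y.left := rfl
@[simp] lemma add_right (x y : SplitObj A M U) : (x + y).right = x.right + y.right := rfl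
@[simp] lemma neg_left (x : SplitObj A M U) : (-x).left = -x.left := rfl
@[simp] lemma neg_right (x : SplitObj A M U) : (-x).right = -x.right := rfl
@[simp] lemma smul_left (c : k) (x : SplitObj A M U) : (c • x).left = c • x.left := rfl
@[simp] lemma smul_right (c : k) (x : SplitObj A M U) : (c • x).right = c • x.right := rfl
@[simp] lemma mul_left (x y : SplitObj A M U) : (x * y).left = x.left * y.left := rfl
@[simp] lemma mul_right (x y : SplitObj A M U) : (x * y).right =
    M.lsmul U x.left y.right + M.rsmul U (.op y.left) x.right := rfl

instance : AddCommGroup (SplitObj A M U) where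
  add_assoc _ _ _ := by ext <;> simp [add_assoc]
  zero_add _ := by ext <;> simp
  add_zero _ := by ext <;> simp
  add_comm _ _ := by ext <;> simp [add_comm]
  neg_add_cancel _ := by ext <;> simp
  nsmul := nsmulRec
  zsmul := zsmulRec

instance : Module k (SplitObj A M U) where
  one_smul _ := by ext <;> simp
  mul_smul _ _ _ := by ext <;> simp [mul_smul]
  smul_zero _ := by ext <;> simp
  smul_add _ _ _ := by ext <;> simp
  add_smul _ _ _ := by ext <;> simp [add_smul]
  zero_smul _ := by ext <;> simp

instance : Ring (SplitObj A M U) where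
  __ := (inferInstance : AddCommGroup (SplitObj A M U))
  left_distrib _ _ _ := by ext <;> simp [mul_add, add_add_add_comm]
  right_distrib _ _ _ := by ext <;> simp [add_mul, add_add_add_comm]
  zero_mul _ := by ext <;> simp
  mul_zero _ := by ext <;> simp
  mul_assoc x y z := by
    ext
    · simp [mul_assoc]
    · simp [M.comm, add_assoc]
  one_mul _ := by ext <;> simp
  mul_one _ := by ext <;> simp

instance : Algebra k (SplitObj A M U) :=
  Algebra.ofModule (fun r x y => by ext <;> simp) (fun r x y => by ext <;> simp)

end SplitObj

variable (A M) in
/-- The presheaf `U ↦ A(U) ⊕ M(U)`. -/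
def splitPresheaf : Cᵒᵖ ⥤ AlgCat.{u} k where
  obj U := AlgCat.of k (SplitObj A M U)
  map {U V} f := AlgCat.ofHom (AlgHom.ofLinearMap
    { toFun := fun x => (⟨A.obj.map f x.left, M.sh.obj.map f x.right⟩ : SplitObj A M V)
      map_add' := fun x y => by ext <;> simp
      map_smul' := fun x y => by ext <;> simp }
    (by ext <;> simp) (fun x y => by ext <;> simp [M.map_lsmul, M.map_rsmul]))
  map_id U := AlgCat.hom_ext _ (AlgHom.ext fun p => SplitObj.ext
    (congr($(A.obj.map_id U) p.left)) (congr($(M.sh.obj.map_id U) p.right)))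
  map_comp f g := AlgCat.hom_ext _ (AlgHom.ext fun p => SplitObj.ext
    (congr($(A.obj.map_comp f g) p.left)) (congr($(M.sh.obj.map_comp f g) p.right)))

variable (A M) in
lemma isSheaf_splitPresheaf : Presheaf.IsSheaf J (splitPresheaf A M) := by
  rw [Presheaf.isSheaf_iff_isSheaf_forget J (splitPresheaf A M) (forget (AlgCat.{u} k)),
    isSheaf_iff_isSheaf_of_type]
  have hA := (isSheaf_iff_isSheaf_of_type J _).1
    ((sheafCompose J (forget (AlgCat.{u} k))).obj A).property
  have hM := (isSheaf_iff_isSheaf_of_type J _).1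
    ((sheafCompose J (forget (ModuleCat.{u} k))).obj M.sh).property
  intro U S hS x hx
  obtain ⟨a, ha, ha'⟩ := hA S hS (fun V f hf => (x f hf : SplitObj A M (op V)).left)
    (fun V₁ V₂ W g₁ g₂ f₁ f₂ h₁ h₂ e => congrArg (SplitObj.left (M := M)) (hx g₁ g₂ h₁ h₂ e))
  obtain ⟨m, hm, hm'⟩ := hM S hS (fun V f hf => (x f hf : SplitObj A M (op V)).right)
    (fun V₁ V₂ W g₁ g₂ f₁ f₂ h₁ h₂ e => congrArg (SplitObj.right (M := M)) (hx g₁ g₂ h₁ h₂ e))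
  refine ⟨(⟨a, m⟩ : SplitObj A M (op U)), fun V f hf => SplitObj.ext (ha f hf) (hm f hf), ?_⟩
  intro y hy
  exact SplitObj.ext
    (ha' (SplitObj.left (M := M) y) fun V f hf => congrArg (SplitObj.left (M := M)) (hy f hf))
    (hm' (SplitObj.right (M := M) y) fun V f hf => congrArg (SplitObj.right (M := M)) (hy f hf))

variable (A M) in
/-- The split extension `A ⊕ M`, with the product `(a, m) (a', m') = (a a', a m' + m a')`. -/
def split : Extension A M where
  B := ⟨splitPresheaf A M, isSheaf_splitPresheaf A M⟩
  proj :=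
    { app := fun U => AlgCat.ofHom (AlgHom.ofLinearMap
        { toFun := SplitObj.left (M := M), map_add' := fun _ _ => rfl, map_smul' := fun _ _ => rfl }
        rfl (fun _ _ => rfl))
      naturality := fun _ _ _ => rfl }
  incl U :=
    { toFun := fun m => (⟨0, m⟩ : SplitObj A M U)
      map_add' := fun x y => SplitObj.ext (add_zero _).symm rfl
      map_smul' := fun c x => SplitObj.ext (smul_zero c).symm rfl }
  incl_naturality {U V} f m := SplitObj.ext (map_zero (A.obj.map f).hom).symm rfl
  incl_injective U m n h := congrArg (SplitObj.right (A := A)) h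
  proj_eq_zero_iff U b := by
    constructor
    · intro h
      exact ⟨SplitObj.right (A := A) b, SplitObj.ext (M := M) h.symm rfl⟩
    · rintro ⟨m, rfl⟩; rfl
  proj_surjective := Presheaf.isLocallySurjective_of_surjective J _ fun U a =>
    ⟨(⟨a, 0⟩ : SplitObj A M U), rfl⟩
  mul_incl U b m := by
    refine SplitObj.ext (mul_zero (M₀ := A.obj.obj U) _) ?_
    change _ + M.rsmul U (.op 0) _ = _
    rw [MulOpposite.op_zero, map_zero]
    exact add_zero _
  incl_mul U b m := by
    refine SplitObj.ext (zero_mul (M₀ := A.obj.obj U) _) ?_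
    change M.lsmul U 0 _ + _ = _
    rw [map_zero]
    exact zero_add _

/-- For `c ≠ 0`: the extension obtained by replacing the inclusion `i : M → B` by `c⁻¹ i`. -/
def scale (E : Extension A M) (c : k) (hc : c ≠ 0) : Extension A M where
  B := E.B
  proj := E.proj
  incl U := c⁻¹ • E.incl U
  incl_naturality {U V} f m := by
    rw [LinearMap.smul_apply, E.incl_naturality, LinearMap.smul_apply, map_smul]
  incl_injective U m n h := by
    have h' : c⁻¹ • E.incl U m = c⁻¹ • E.incl U n := h
    exact E.incl_injective U (smul_right_injective _ (inv_ne_zero hc) h')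
  proj_eq_zero_iff U b := by
    rw [E.proj_eq_zero_iff]
    constructor
    · rintro ⟨m, rfl⟩
      exact ⟨c • m, by rw [LinearMap.smul_apply, map_smul, inv_smul_smul₀ hc]⟩
    · rintro ⟨m, rfl⟩
      exact ⟨c⁻¹ • m, by rw [LinearMap.smul_apply, map_smul]⟩
  proj_surjective := E.proj_surjective
  mul_incl U b m := by
    rw [LinearMap.smul_apply, mul_smul_comm, E.mul_incl, LinearMap.smul_apply]
  incl_mul U b m := by
    rw [LinearMap.smul_apply, smul_mul_assoc, E.incl_mul, LinearMap.smul_apply]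

open Classical in
/-- The pushout of an extension `0 → M → B → A → 0` along the multiplication by `c` on `M`. For
`c ≠ 0` this multiplication is invertible and the pushout is `B` itself with the inclusion `c⁻¹ i`;
for `c = 0` it is the split extension. -/
def smul (c : k) (E : Extension A M) : Extension A M :=
  if hc : c = 0 then split A M else E.scale c hc


/-! ### The vector space structure on equivalence classes -/

/-- `E₃` receives a map from `B₁ ×_A B₂` over `A` that restricts to the addition of `M`. -/
def IsSum (E₁ E₂ E₃ : Extension A M) : Prop :=
  ∃ ψ : (fib E₁.proj E₂.proj).functor ⟶ E₃.B.obj,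
    (∀ U p, E₃.proj.app U (ψ.app U p) = E₁.proj.app U ((fib E₁.proj E₂.proj).fst.app U p)) ∧
    ∀ U m n, ψ.app U ⟨(E₁.incl U m, E₂.incl U n), mem_fib E₁ E₂ U m n⟩ = E₃.incl U (m + n)

/-- `E'` receives a map from `E` over `A` that restricts to multiplication by `c` on `M`. -/
def IsSMul (c : k) (E E' : Extension A M) : Prop :=
  ∃ φ : E.B.obj ⟶ E'.B.obj, (∀ U b, E'.proj.app U (φ.app U b) = E.proj.app U b) ∧
    ∀ U m, φ.app U (E.incl U m) = E'.incl U (c • m)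

lemma isSum_sum (E₁ E₂ : Extension A M) : IsSum E₁ E₂ (sum E₁ E₂) :=
  ⟨toSumPresheaf E₁ E₂ ≫ toSumSheaf E₁ E₂, fun U _ => sumProj_apply E₁ E₂ U _,
    fun U m n => congrArg ((toSumSheaf E₁ E₂).app U) (sumPresheafIncl_add E₁ E₂ U m n)⟩

lemma isSMul_smul (c : k) (E : Extension A M) : IsSMul c E (smul c E) := by
  unfold smul
  split_ifs with hc
  · refine ⟨{ app := fun U => AlgCat.ofHom (AlgHom.ofLinearMap
        { toFun := fun b => (⟨E.proj.app U b, 0⟩ : SplitObj A M U)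
          map_add' := fun x y => by ext <;> simp
          map_smul' := fun x y => by ext <;> simp }
        (by ext <;> simp) (fun x y => by ext <;> simp)), naturality := ?_ }, ?_, ?_⟩
    · intro U V f
      refine AlgCat.hom_ext _ (AlgHom.ext fun p => SplitObj.ext (map_apply E.proj f p) ?_)
      exact (map_zero (M.sh.obj.map f).hom).symm
    · intro U b; rfl
    · intro U m
      refine SplitObj.ext (E.proj_incl U m) ?_
      change 0 = c • m
      rw [hc, zero_smul]
  · refine ⟨𝟙 _, fun U b => rfl, fun U m => ?_⟩
    change E.incl U m = c⁻¹ • E.incl U (c • m)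
    rw [map_smul, inv_smul_smul₀ hc]

lemma mem_fib' {E₁ E₂ : Extension A M} {U : Cᵒᵖ} (p : (fib E₁.proj E₂.proj).functor.obj U) :
    E₁.proj.app U ((fib E₁.proj E₂.proj).fst.app U p) =
      E₂.proj.app U ((fib E₁.proj E₂.proj).snd.app U p) := p.2

lemma fib_cases {E₁ E₂ : Extension A M} {U : Cᵒᵖ} (p : (fib E₁.proj E₂.proj).functor.obj U)
    (h : E₁.proj.app U ((fib E₁.proj E₂.proj).fst.app U p) = 0) :
    ∃ m n, p = ⟨(E₁.incl U m, E₂.incl U n), mem_fib E₁ E₂ U m n⟩ := by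
  obtain ⟨m, hm⟩ := (E₁.proj_eq_zero_iff U _).1 h
  obtain ⟨n, hn⟩ := (E₂.proj_eq_zero_iff U _).1 ((mem_fib' p).symm.trans h)
  exact ⟨m, n, Subtype.ext (Prod.ext hm.symm hn.symm)⟩

lemma fib_surjective {P Q A : Cᵒᵖ ⥤ AlgCat.{u} k} (p : P ⟶ A) (q : Q ⟶ A)
    (hp : Presheaf.IsLocallySurjective J p) (hq : Presheaf.IsLocallySurjective J q) :
    Presheaf.IsLocallySurjective J ((fib p q).fst ≫ p) := by
  constructor
  intro U a
  refine J.superset_covering ?_ (J.intersection_covering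
    (hp.imageSieve_mem a) (hq.imageSieve_mem a))
  rintro V f ⟨⟨b, hb⟩, ⟨b', hb'⟩⟩
  exact ⟨⟨(b, b'), hb.trans hb'.symm⟩, hb⟩

lemma IsSum.comm {E₁ E₂ E₃ : Extension A M} (h : IsSum E₁ E₂ E₃) : IsSum E₂ E₁ E₃ := by
  obtain ⟨ψ, h, h'⟩ := h
  refine ⟨(fib E₁.proj E₂.proj).lift (fib E₂.proj E₁.proj).snd (fib E₂.proj E₁.proj).fst
    (fun U p => (mem_fib' p).symm) ≫ ψ, fun U p => ?_, fun U m n => ?_⟩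
  · exact (h U _).trans (mem_fib' p).symm
  · rw [add_comm m n]
    exact h' U n m

lemma IsSum.equivalent {E₁ E₂ E E' : Extension A M} (h : IsSum E₁ E₂ E) (h' : IsSum E₁ E₂ E') :
    Equivalent E E' := by
  obtain ⟨ψ, h1, h2⟩ := h
  obtain ⟨ψ', h1', h2'⟩ := h'
  have e1 : ψ ≫ E.proj = (fib E₁.proj E₂.proj).fst ≫ E₁.proj := by
    ext U p; exact h1 U p
  have e2 : ψ' ≫ E'.proj = (fib E₁.proj E₂.proj).fst ≫ E₁.proj := by
    ext U p; exact h1' U p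
  refine equivalent_of_span ψ ψ' (e1.trans e2.symm) ?_ fun U p hp => ?_
  · rw [e1]; exact fib_surjective _ _ E₁.proj_surjective E₂.proj_surjective
  · rw [h1] at hp
    obtain ⟨m, n, rfl⟩ := fib_cases p hp
    exact ⟨m + n, h2 U m n, h2' U m n⟩

lemma IsSMul.equivalent {c : k} {E₁ E E' : Extension A M} (h : IsSMul c E₁ E)
    (h' : IsSMul c E₁ E') : Equivalent E E' := by
  obtain ⟨ψ, h1, h2⟩ := h
  obtain ⟨ψ', h1', h2'⟩ := h'
  have e1 : ψ ≫ E.proj = E₁.proj := by ext U p; exact h1 U p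
  have e2 : ψ' ≫ E'.proj = E₁.proj := by ext U p; exact h1' U p
  refine equivalent_of_span ψ ψ' (e1.trans e2.symm) ?_ fun U p hp => ?_
  · rw [e1]; exact E₁.proj_surjective
  · rw [h1] at hp
    obtain ⟨m, rfl⟩ := (E₁.proj_eq_zero_iff U p).1 hp
    exact ⟨c • m, h2 U m, h2' U m⟩

lemma Equivalent.isSMul_one {E E' : Extension A M} (h : Equivalent E E') : IsSMul 1 E E' := by
  obtain ⟨α, h, h'⟩ := h
  exact ⟨α.hom, fun U b => congr($(h).app U b), fun U m => by rw [h', one_smul]⟩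

lemma IsSMul.trans {c d : k} {E₁ E₂ E₃ : Extension A M} (h : IsSMul c E₁ E₂)
    (h' : IsSMul d E₂ E₃) : IsSMul (d * c) E₁ E₃ := by
  obtain ⟨φ, h1, h2⟩ := h
  obtain ⟨φ', h1', h2'⟩ := h'
  refine ⟨φ ≫ φ', fun U b => (h1' U _).trans (h1 U b), fun U m => ?_⟩
  change φ'.app U (φ.app U _) = _
  rw [h2, h2', mul_smul]

/-- The map of fibre products induced by maps over `A`. -/
def fibMap {E₁ E₂ F₁ F₂ : Extension A M} (φ : F₁.B.obj ⟶ E₁.B.obj) (ψ : F₂.B.obj ⟶ E₂.B.obj)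
    (hφ : ∀ U b, E₁.proj.app U (φ.app U b) = F₁.proj.app U b)
    (hψ : ∀ U b, E₂.proj.app U (ψ.app U b) = F₂.proj.app U b) :
    (fib F₁.proj F₂.proj).functor ⟶ (fib E₁.proj E₂.proj).functor :=
  (fib E₁.proj E₂.proj).lift ((fib F₁.proj F₂.proj).fst ≫ φ) ((fib F₁.proj F₂.proj).snd ≫ ψ)
    (fun U p => (hφ U _).trans ((mem_fib' p).trans (hψ U _).symm))

lemma IsSum.congr_left {E₁ E₂ E₃ F₁ : Extension A M} (h : IsSum E₁ E₂ E₃)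
    (h₁ : Equivalent F₁ E₁) : IsSum F₁ E₂ E₃ := by
  obtain ⟨ψ, h, h'⟩ := h
  obtain ⟨φ, g, g'⟩ := h₁.isSMul_one
  refine ⟨fibMap φ (𝟙 _) g (fun U b => rfl) ≫ ψ, fun U p => (h U _).trans (g U _), fun U m n => ?_⟩
  rw [← h']
  refine congrArg (ψ.app U) (Subtype.ext (Prod.ext ((g' U m).trans ?_) rfl))
  rw [one_smul]

lemma IsSum.congr {E₁ E₂ E₃ F₁ F₂ : Extension A M} (h : IsSum E₁ E₂ E₃)
    (h₁ : Equivalent F₁ E₁) (h₂ : Equivalent F₂ E₂) : IsSum F₁ F₂ E₃ :=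
  ((h.congr_left h₁).comm.congr_left h₂).comm

lemma IsSum.assoc {E₁ E₂ E₃ E₁₂ E₂₃ F F' : Extension A M} (h₁₂ : IsSum E₁ E₂ E₁₂)
    (h₂₃ : IsSum E₂ E₃ E₂₃) (h : IsSum E₁₂ E₃ F) (h' : IsSum E₁ E₂₃ F') : Equivalent F F' := by
  obtain ⟨α, a, a'⟩ := h₁₂
  obtain ⟨β, b, b'⟩ := h₂₃
  obtain ⟨ψ, c, c'⟩ := h
  obtain ⟨ψ', d, d'⟩ := h'
  let S := fib E₁.proj E₂.proj
  let T := fib (S.fst ≫ E₁.proj) E₃.proj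
  have hT : ∀ U (p : T.functor.obj U), E₁.proj.app U (S.fst.app U (T.fst.app U p)) =
    E₃.proj.app U (T.snd.app U p) := fun U p => p.2
  let p₂₃ : T.functor ⟶ (fib E₂.proj E₃.proj).functor :=
    (fib E₂.proj E₃.proj).lift (T.fst ≫ S.snd) T.snd
      (fun U p => (mem_fib' (T.fst.app U p)).symm.trans (hT U p))
  let φ : T.functor ⟶ F.B.obj :=
    (fib E₁₂.proj E₃.proj).lift (T.fst ≫ α) T.snd (fun U p => (a U _).trans (hT U p)) ≫ ψ
  let φ' : T.functor ⟶ F'.B.obj :=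
    (fib E₁.proj E₂₃.proj).lift (T.fst ≫ S.fst) (p₂₃ ≫ β)
      (fun U p => (mem_fib' (T.fst.app U p)).trans (b U (p₂₃.app U p)).symm) ≫ ψ'
  have e1 : φ ≫ F.proj = T.fst ≫ S.fst ≫ E₁.proj := by
    ext U p; exact (c U _).trans (a U _)
  have e2 : φ' ≫ F'.proj = T.fst ≫ S.fst ≫ E₁.proj := by
    ext U p; exact d U _
  refine equivalent_of_span φ φ' (e1.trans e2.symm) ?_ fun U p hp => ?_
  · rw [e1]
    exact fib_surjective _ _ (fib_surjective _ _ E₁.proj_surjective E₂.proj_surjective)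
      E₃.proj_surjective
  · have hp' : E₁.proj.app U (S.fst.app U (T.fst.app U p)) = 0 := congr($(e1).app U p).symm.trans hp
    obtain ⟨m₁, m₂, h12⟩ := fib_cases (T.fst.app U p) hp'
    obtain ⟨m₃, h3⟩ := (E₃.proj_eq_zero_iff U _).1 ((hT U p).symm.trans hp')
    refine ⟨m₁ + m₂ + m₃, ?_, ?_⟩
    · rw [← c']
      refine congrArg (ψ.app U) (Subtype.ext (Prod.ext ?_ h3.symm))
      exact (congrArg (α.app U) h12).trans (a' U m₁ m₂)
    · rw [add_assoc, ← d']
      refine congrArg (ψ'.app U) (Subtype.ext (Prod.ext congr(($h12).1.1) ?_))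
      have h23 : p₂₃.app U p = ⟨(E₂.incl U m₂, E₃.incl U m₃), mem_fib E₂ E₃ U m₂ m₃⟩ :=
        Subtype.ext (Prod.ext congr(($h12).1.2) h3.symm)
      exact (congrArg (β.app U) h23).trans (b' U m₂ m₃)

lemma IsSum.smul_add {c : k} {E₁ E₂ E₃ F₁ F₂ F₃ F : Extension A M} (h : IsSum E₁ E₂ E₃)
    (h₁ : IsSMul c E₁ F₁) (h₂ : IsSMul c E₂ F₂) (h₃ : IsSMul c E₃ F) (h' : IsSum F₁ F₂ F₃) :
    Equivalent F F₃ := by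
  obtain ⟨ψ, a, a'⟩ := h
  obtain ⟨φ₁, b, b'⟩ := h₁
  obtain ⟨φ₂, c, c'⟩ := h₂
  obtain ⟨φ₃, d, d'⟩ := h₃
  obtain ⟨ψ', e, e'⟩ := h'
  have e1 : (ψ ≫ φ₃) ≫ F.proj = (fib E₁.proj E₂.proj).fst ≫ E₁.proj := by
    ext U p; exact (d U _).trans (a U _)
  have e2 : (fibMap φ₁ φ₂ b c ≫ ψ') ≫ F₃.proj = (fib E₁.proj E₂.proj).fst ≫ E₁.proj := by
    ext U p; exact (e U _).trans (b U _)
  refine equivalent_of_span (ψ ≫ φ₃) (fibMap φ₁ φ₂ b c ≫ ψ') (e1.trans e2.symm) ?_ fun U p hp => ?_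
  · rw [e1]
    exact fib_surjective _ _ E₁.proj_surjective E₂.proj_surjective
  · obtain ⟨m, n, rfl⟩ := fib_cases p (congr($(e1).app U p).symm.trans hp)
    refine ⟨_, (congrArg (φ₃.app U) (a' U m n)).trans (d' U _), ?_⟩
    rw [_root_.smul_add, ← e']
    exact congrArg (ψ'.app U) (Subtype.ext (Prod.ext (b' U m) (c' U n)))

lemma IsSum.add_smul {c d : k} {E F₁ F₂ F₃ F : Extension A M}
    (h₁ : IsSMul c E F₁) (h₂ : IsSMul d E F₂) (h : IsSMul (c + d) E F) (h' : IsSum F₁ F₂ F₃) :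
    Equivalent F F₃ := by
  obtain ⟨φ₁, b, b'⟩ := h₁
  obtain ⟨φ₂, c, c'⟩ := h₂
  obtain ⟨φ, d, d'⟩ := h
  obtain ⟨ψ, e, e'⟩ := h'
  let φ' := (fib F₁.proj F₂.proj).lift φ₁ φ₂ (fun U x => (b U x).trans (c U x).symm) ≫ ψ
  have e1 : φ ≫ F.proj = E.proj := by ext U p; exact d U _
  have e2 : φ' ≫ F₃.proj = E.proj := by ext U p; exact (e U _).trans (b U _)
  refine equivalent_of_span φ φ' (e1.trans e2.symm) ?_ fun U p hp => ?_
  · rw [e1]; exact E.proj_surjective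
  · obtain ⟨m, rfl⟩ := (E.proj_eq_zero_iff U p).1 ((d U p).symm.trans hp)
    refine ⟨_, d' U m, ?_⟩
    rw [_root_.add_smul, ← e']
    exact congrArg (ψ.app U) (Subtype.ext (Prod.ext (b' U m) (c' U m)))

lemma smul_zero_eq (E : Extension A M) : smul 0 E = split A M := by
  unfold smul; rw [dif_pos rfl]

/-- Equivalence of extensions as a setoid. -/
instance setoid (A : Sheaf J (AlgCat.{u} k)) (M : Bimod A) : Setoid (Extension A M) where
  r := Equivalent
  iseqv := ⟨refl, symm, _root_.trans⟩

end Extension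

/-- The set `exal(A, M)` of isomorphism classes of algebra extensions of `A` by `M`. Below it gets its
usual structure of a `k`-vector space: the sum is the Baer sum, zero is the class of the split
extension, and `c ∈ k` acts by pushout along the multiplication by `c` on `M`. -/
def Exal (A : Sheaf J (AlgCat.{u} k)) (M : Bimod A) : Type (u + 1) :=
  Quotient (Extension.setoid A M)

namespace Exal
open Extension
variable {A : Sheaf J (AlgCat.{u} k)} {M : Bimod A}

/-- The class of an extension. -/
def mk (E : Extension A M) : Exal A M := Quotient.mk _ E

lemma mk_eq {E E' : Extension A M} : mk E = mk E' ↔ Equivalent E E' := Quotient.eq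

instance : Zero (Exal A M) := ⟨mk (split A M)⟩

instance : Add (Exal A M) := ⟨Quotient.map₂ sum fun _ _ h _ _ h' =>
  (isSum_sum _ _).equivalent ((isSum_sum _ _).congr h h')⟩

instance : SMul k (Exal A M) := ⟨fun c => Quotient.map (smul c) fun E E' h => by
  have := (Equivalent.isSMul_one h).trans (isSMul_smul c E')
  rw [mul_one] at this
  exact (isSMul_smul c E).equivalent this⟩

instance : Neg (Exal A M) := ⟨fun x => (-1 : k) • x⟩

lemma mk_add (E E' : Extension A M) : mk E + mk E' = mk (sum E E') := rfl
lemma mk_smul (c : k) (E : Extension A M) : c • mk E = mk (smul c E) := rfl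
lemma zero_eq : (0 : Exal A M) = mk (split A M) := rfl

lemma zero_smul' (x : Exal A M) : (0 : k) • x = 0 := by
  obtain ⟨E, rfl⟩ := Quotient.exists_rep x
  exact congrArg mk (smul_zero_eq E)

lemma one_smul' (x : Exal A M) : (1 : k) • x = x := by
  obtain ⟨E, rfl⟩ := Quotient.exists_rep x
  exact mk_eq.2 ((isSMul_smul 1 E).equivalent (Equivalent.isSMul_one (refl E)))

lemma mul_smul' (c d : k) (x : Exal A M) : (c * d) • x = c • d • x := by
  obtain ⟨E, rfl⟩ := Quotient.exists_rep x
  exact mk_eq.2 ((isSMul_smul _ E).equivalent ((isSMul_smul d E).trans (isSMul_smul c _)))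

lemma add_smul' (c d : k) (x : Exal A M) : (c + d) • x = c • x + d • x := by
  obtain ⟨E, rfl⟩ := Quotient.exists_rep x
  exact mk_eq.2 (IsSum.add_smul (isSMul_smul c E) (isSMul_smul d E) (isSMul_smul _ E)
    (isSum_sum _ _))

lemma smul_add' (c : k) (x y : Exal A M) : c • (x + y) = c • x + c • y := by
  obtain ⟨E, rfl⟩ := Quotient.exists_rep x
  obtain ⟨F, rfl⟩ := Quotient.exists_rep y
  exact mk_eq.2 ((isSum_sum E F).smul_add (isSMul_smul c E) (isSMul_smul c F) (isSMul_smul c _)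
    (isSum_sum _ _))

lemma zero_add' (x : Exal A M) : 0 + x = x := by
  rw [← zero_smul' x]
  conv_lhs => rw [← one_smul' x, ← mul_smul', ← add_smul']
  rw [mul_one, zero_add, one_smul']

lemma add_comm' (x y : Exal A M) : x + y = y + x := by
  obtain ⟨E, rfl⟩ := Quotient.exists_rep x
  obtain ⟨F, rfl⟩ := Quotient.exists_rep y
  exact mk_eq.2 ((isSum_sum E F).equivalent (isSum_sum F E).comm)

instance : AddCommGroup (Exal A M) where
  add_assoc x y z := by
    obtain ⟨E, rfl⟩ := Quotient.exists_rep x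
    obtain ⟨F, rfl⟩ := Quotient.exists_rep y
    obtain ⟨G, rfl⟩ := Quotient.exists_rep z
    exact mk_eq.2 (IsSum.assoc (isSum_sum E F) (isSum_sum F G) (isSum_sum _ _) (isSum_sum _ _))
  zero_add := zero_add'
  add_zero x := by rw [add_comm', zero_add']
  add_comm := add_comm'
  neg_add_cancel x := by
    change (-1 : k) • x + x = 0
    conv_lhs => rw [← one_smul' x, ← mul_smul', ← add_smul']
    rw [mul_one, neg_add_cancel, zero_smul']
  nsmul := nsmulRec
  zsmul := zsmulRec

instance : Module k (Exal A M) where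
  one_smul := one_smul'
  mul_smul := mul_smul'
  smul_zero c := by
    rw [← zero_smul' (0 : Exal A M), ← mul_smul', mul_zero]
  smul_add := smul_add'
  add_smul := add_smul'
  zero_smul := zero_smul'

end Exal

/-! ### First order deformations -/

/-- The sheaf of `k`-algebras underlying a sheaf of `k[ε]`-algebras. -/
def underlying (B : Sheaf J (AlgCat.{u} (DualNumber k))) : Sheaf J (AlgCat.{u} k) where
  obj := B.obj ⋙ AlgCat.restrictScalars (algebraMap k (DualNumber k))
  property := by
    rw [Presheaf.isSheaf_iff_isSheaf_forget J _ (forget (AlgCat.{u} k))]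
    exact ((sheafCompose J (forget (AlgCat.{u} (DualNumber k)))).obj B).property

/-- A first order deformation of a sheaf of algebras `A`: a sheaf `B` of algebras over the dual
numbers `k[ε]` together with an isomorphism of graded `k[ε]`-algebras `θ : gr B ≅ A ⊗ₖ k[ε]`, where
`gr B = B/εB ⊕ εB` belongs to the filtration `0 ⊆ εB ⊆ B` and `A ⊗ₖ k[ε] = A ⊕ Aε`.
The part of `θ` in degree 0 is an isomorphism of algebras `B/εB ≅ A`, given by the epimorphism
`proj : B → A` with kernel `εB`. The part in degree 1 is an isomorphism `εB ≅ A`, whose inverse is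
`incl : A → B`, a monomorphism with image `εB`. That `θ` commutes with the multiplication by `ε`
is `eps_smul`. (By `eps_smul` the image of `incl` is indeed the subsheaf `εB`, and the
multiplicativity of `θ` in the remaining degrees is automatic, see `mul_incl` and `incl_mul`.) -/
structure Deformation (A : Sheaf J (AlgCat.{u} k)) where
  B : Sheaf J (AlgCat.{u} (DualNumber k))
  proj : (underlying B).obj ⟶ A.obj
  incl : ∀ U : Cᵒᵖ, A.obj.obj U →ₗ[k] (underlying B).obj.obj U
  incl_naturality : ∀ {U V : Cᵒᵖ} (f : U ⟶ V) (a : A.obj.obj U),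
    incl V (A.obj.map f a) = (underlying B).obj.map f (incl U a)
  incl_injective : ∀ U, Function.Injective (incl U)
  proj_eq_zero_iff : ∀ (U : Cᵒᵖ) (b : (underlying B).obj.obj U),
    proj.app U b = 0 ↔ ∃ a, incl U a = b
  proj_surjective : Presheaf.IsLocallySurjective J proj
  eps_smul : ∀ (U : Cᵒᵖ) (b : B.obj.obj U),
    (DualNumber.eps : DualNumber k) • b = incl U (proj.app U b)

namespace Deformation
variable {A : Sheaf J (AlgCat.{u} k)}

/-- Isomorphism of deformations: an isomorphism of sheaves of `k[ε]`-algebras that is compatible with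
the isomorphisms `θ`, that is, with `proj` and `incl`. -/
def Equivalent (D D' : Deformation A) : Prop :=
  ∃ α : D.B.obj ≅ D'.B.obj,
    (∀ U (b : D.B.obj.obj U), D'.proj.app U (α.hom.app U b) = D.proj.app U b) ∧
    ∀ U a, α.hom.app U (D.incl U a) = D'.incl U a

lemma mul_incl (D : Deformation A) (U : Cᵒᵖ) (b : (underlying D.B).obj.obj U)
    (a : A.obj.obj U) : b * D.incl U a = D.incl U (D.proj.app U b * a) := by
  refine Extension.alg_ext (underlying D.B) _ (D.proj_surjective.imageSieve_mem a) _ _ ?_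
  rintro V f ⟨c, hc⟩
  rw [map_mul, ← D.incl_naturality, ← D.incl_naturality, map_mul, ← map_apply, ← hc, ← map_mul]
  refine (congrArg _ (D.eps_smul _ c).symm).trans (Eq.trans ?_ (D.eps_smul _ _))
  exact mul_smul_comm (β := D.B.obj.obj (op V)) _ _ _

lemma incl_mul (D : Deformation A) (U : Cᵒᵖ) (b : (underlying D.B).obj.obj U)
    (a : A.obj.obj U) : D.incl U a * b = D.incl U (a * D.proj.app U b) := by
  refine Extension.alg_ext (underlying D.B) _ (D.proj_surjective.imageSieve_mem a) _ _ ?_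
  rintro V f ⟨c, hc⟩
  rw [map_mul, ← D.incl_naturality, ← D.incl_naturality, map_mul, ← map_apply, ← hc, ← map_mul]
  refine (congrArg (fun z : (underlying D.B).obj.obj (op V) =>
    z * (underlying D.B).obj.map f.op b) (D.eps_smul _ c).symm).trans (Eq.trans ?_ (D.eps_smul _ _))
  exact smul_mul_assoc (β := D.B.obj.obj (op V)) _ _ _

/-- The extension `0 → A → B → A → 0` given by a deformation. -/
def toExtension (D : Deformation A) : Extension A (Bimod.self A) where
  B := underlying D.B
  proj := D.proj
  incl := D.incl
  incl_naturality := D.incl_naturality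
  incl_injective := D.incl_injective
  proj_eq_zero_iff := D.proj_eq_zero_iff
  proj_surjective := D.proj_surjective
  mul_incl := D.mul_incl
  incl_mul := D.incl_mul

lemma algebraMap_eq (D : Deformation A) (U : Cᵒᵖ) (x : DualNumber k) :
    algebraMap (DualNumber k) (D.B.obj.obj U) x =
      algebraMap k ((underlying D.B).obj.obj U) x.fst + D.incl U (x.snd • 1) := by
  have h1 : D.incl U (x.snd • 1) = algebraMap (DualNumber k) (D.B.obj.obj U)
      (TrivSqZeroExt.inl x.snd * DualNumber.eps) := by
    have := D.eps_smul U 1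
    erw [map_one (D.proj.app U).hom] at this
    rw [map_smul, ← this]
    change (algebraMap k (DualNumber k) x.snd) •
      ((DualNumber.eps : DualNumber k) • (1 : D.B.obj.obj U)) = _
    rw [Algebra.smul_def, Algebra.smul_def, mul_one, map_mul]
    rfl
  rw [h1]
  refine Eq.trans (congrArg _ ?_) (map_add (algebraMap (DualNumber k) (D.B.obj.obj U))
    (TrivSqZeroExt.inl x.fst) _)
  ext <;> simp

lemma equivalent_iff (D D' : Deformation A) :
    Equivalent D D' ↔ Extension.Equivalent D.toExtension D'.toExtension := by
  constructor
  · rintro ⟨α, h, h'⟩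
    exact ⟨Functor.isoWhiskerRight α _, by ext U b; exact h U b, h'⟩
  · rintro ⟨α, h, h'⟩
    refine ⟨NatIso.ofComponents (fun U => AlgEquiv.toAlgebraIso (AlgEquiv.ofRingEquiv
      (f := ((CategoryTheory.Iso.toAlgEquiv (α.app U)).toRingEquiv :
        D.B.obj.obj U ≃+* D'.B.obj.obj U)) ?_)) ?_, ?_, ?_⟩
    · intro x
      rw [algebraMap_eq, algebraMap_eq]
      refine (map_add (α.hom.app U).hom _ _).trans ?_
      refine congrArg₂ _ ((α.hom.app U).hom.commutes _) (h' U _)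
    · intro U V f
      refine AlgCat.hom_ext _ (AlgHom.ext fun p => ?_)
      exact map_apply α.hom f p
    · intro U b; exact congr($(h).app U b)
    · exact h'

/-- Isomorphism of deformations as a setoid. -/
instance setoid (A : Sheaf J (AlgCat.{u} k)) : Setoid (Deformation A) where
  r := Equivalent
  iseqv := ⟨fun D => (equivalent_iff D D).2 (refl _),
    fun h => (equivalent_iff _ _).2 (symm ((equivalent_iff _ _).1 h)),
    fun h h' => (equivalent_iff _ _).2
      (_root_.trans ((equivalent_iff _ _).1 h) ((equivalent_iff _ _).1 h'))⟩

section OfExtension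
variable (E : Extension A (Bimod.self A))

/-- The action of `ε` on an extension of `A` by `A` is multiplication by the image of `1`. -/
def eps (U : Cᵒᵖ) : E.B.obj.obj U := E.incl U (1 : A.obj.obj U)

lemma eps_mul (U : Cᵒᵖ) (b : E.B.obj.obj U) : eps E U * b = E.incl U (E.proj.app U b) := by
  refine (E.incl_mul U b _).trans (congrArg (E.incl U) ?_)
  exact one_mul (M := A.obj.obj U) _

lemma mul_eps (U : Cᵒᵖ) (b : E.B.obj.obj U) : b * eps E U = E.incl U (E.proj.app U b) := by
  refine (E.mul_incl U b _).trans (congrArg (E.incl U) ?_)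
  exact mul_one (M := A.obj.obj U) _

lemma map_eps {U V : Cᵒᵖ} (f : U ⟶ V) : E.B.obj.map f (eps E U) = eps E V := by
  refine (E.incl_naturality f _).symm.trans (congrArg (E.incl V) ?_)
  exact map_one (A.obj.map f).hom

/-- The structure map of the `k[ε]`-algebra. -/
def structureMap (U : Cᵒᵖ) : DualNumber k →ₐ[k] E.B.obj.obj U :=
  DualNumber.lift ⟨(Algebra.ofId k _, eps E U), E.incl_mul_incl U _ _,
    fun r => (Algebra.commutes r (eps E U)).symm⟩

lemma structureMap_apply (U : Cᵒᵖ) (x : DualNumber k) :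
    structureMap E U x = algebraMap k _ x.fst + algebraMap k _ x.snd * eps E U := by
  simp [structureMap, DualNumber.lift_apply_apply, Algebra.ofId_apply]

/-- The `k[ε]`-algebra structure on the sections of an extension of `A` by `A`. -/
abbrev dualAlgebra (U : Cᵒᵖ) : Algebra (DualNumber k) (E.B.obj.obj U) :=
  RingHom.toAlgebra' (structureMap E U).toRingHom fun x b => by
    change structureMap E U x * b = b * structureMap E U x
    rw [structureMap_apply, add_mul, mul_add, mul_assoc, eps_mul, ← mul_eps, Algebra.commutes,
      Algebra.left_comm]

/-- The sheaf of `k[ε]`-algebras given by an extension of `A` by `A`. -/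
def dualPresheaf : Cᵒᵖ ⥤ AlgCat.{u} (DualNumber k) where
  obj U := letI := dualAlgebra E U; AlgCat.of (DualNumber k) (E.B.obj.obj U)
  map {U V} f :=
    letI := dualAlgebra E U
    letI := dualAlgebra E V
    AlgCat.ofHom
      { (E.B.obj.map f).hom.toRingHom with
        commutes' := fun x => by
          change E.B.obj.map f (structureMap E U x) = structureMap E V x
          rw [structureMap_apply, structureMap_apply, map_add, map_mul, map_eps]
          exact congrArg₂ (fun a b => a + b * _) ((E.B.obj.map f).hom.commutes _)
            ((E.B.obj.map f).hom.commutes _) }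
  map_id U := AlgCat.hom_ext _ (AlgHom.ext fun b => congr($(E.B.obj.map_id U) b))
  map_comp f g := AlgCat.hom_ext _ (AlgHom.ext fun b => congr($(E.B.obj.map_comp f g) b))

/-- The sheaf of `k[ε]`-algebras given by an extension of `A` by `A`. -/
def dualSheaf : Sheaf J (AlgCat.{u} (DualNumber k)) where
  obj := dualPresheaf E
  property := by
    rw [Presheaf.isSheaf_iff_isSheaf_forget J _ (forget (AlgCat.{u} (DualNumber k)))]
    exact ((sheafCompose J (forget (AlgCat.{u} k))).obj E.B).property

/-- The identity map on sections. -/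
def underlyingDualAlgHom (U : Cᵒᵖ) :
    (underlying (dualSheaf E)).obj.obj U →ₐ[k] E.B.obj.obj U where
  toFun := fun b => b
  map_one' := rfl
  map_mul' := fun _ _ => rfl
  map_zero' := rfl
  map_add' := fun _ _ => rfl
  commutes' := fun c => (structureMap E U).commutes c

/-- The identity map. -/
def underlyingDualHom : (underlying (dualSheaf E)).obj ⟶ E.B.obj where
  app U := (AlgCat.ofHom (underlyingDualAlgHom E U) :)
  naturality _ _ _ := rfl

/-- The deformation given by an extension of `A` by `A`. -/
def ofExtension : Deformation A where
  B := dualSheaf E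
  proj := underlyingDualHom E ≫ E.proj
  incl U :=
    { toFun := fun a => (E.incl U a : E.B.obj.obj U)
      map_add' := fun a b => map_add (E.incl U) a b
      map_smul' := fun c a => by
        refine (map_smul (E.incl U) c a).trans ((Algebra.smul_def c (E.incl U a)).trans ?_)
        refine Eq.trans ?_ (Algebra.smul_def (A := (underlying (dualSheaf E)).obj.obj U) c _).symm
        exact congrArg (· * E.incl U a) ((structureMap E U).commutes c).symm }
  incl_naturality f a := E.incl_naturality f a
  incl_injective U := E.incl_injective U
  proj_eq_zero_iff U b := E.proj_eq_zero_iff U b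
  proj_surjective := by
    constructor
    intro U a
    exact E.proj_surjective.imageSieve_mem a
  eps_smul U b := by
    refine Eq.trans ?_ (eps_mul E U b)
    refine congrArg (· * (b : E.B.obj.obj U)) ((structureMap_apply E U _).trans ?_)
    simp

lemma toExtension_ofExtension : Extension.Equivalent (ofExtension E).toExtension E :=
  Extension.equivalent_of_hom (underlyingDualHom E) rfl fun _ _ => rfl

end OfExtension

end Deformation

/-- The set `def(A)` of isomorphism classes of first order deformations of `A`. Its structure of a
`k`-vector space is that of `exal(A, A)`, see `Def.equivExal`. -/
def Def (A : Sheaf J (AlgCat.{u} k)) : Type (u + 1) := Quotient (Deformation.setoid A)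

namespace Def
variable {A : Sheaf J (AlgCat.{u} k)}

/-- The class of a deformation. -/
def mk (D : Deformation A) : Def A := Quotient.mk _ D

/-- The identification `def(A) = exal(A, A)`: a deformation `B` of `A` is sent to the extension
`0 → A → B → A → 0`; conversely `ε` acts on an extension of `A` by `A` as the image of `1`. -/
def equivExal (A : Sheaf J (AlgCat.{u} k)) : Def A ≃ Exal A (Bimod.self A) :=
  Equiv.ofBijective (Quotient.map Deformation.toExtension
    fun D D' h => (Deformation.equivalent_iff D D').1 h) (by
      constructor
      · intro x y h
        obtain ⟨D, rfl⟩ := Quotient.exists_rep x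
        obtain ⟨D', rfl⟩ := Quotient.exists_rep y
        exact Quotient.sound ((Deformation.equivalent_iff D D').2 (Quotient.exact h))
      · intro x
        obtain ⟨E, rfl⟩ := Quotient.exists_rep x
        exact ⟨mk (Deformation.ofExtension E),
          Quotient.sound (Deformation.toExtension_ofExtension E)⟩)

lemma equivExal_mk (D : Deformation A) : equivExal A (mk D) = Exal.mk D.toExtension := rfl

instance : AddCommGroup (Def A) := (equivExal A).addCommGroup

instance : Module k (Def A) := (equivExal A).module k

end Def

/-! ### Restriction to presheaves on another category -/

section Restrict
variable {D : Type u} [SmallCategory D] (j : D ⥤ C) {A : Sheaf J (AlgCat.{u} k)}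

/-- The restriction of a sheaf along `j : D ⥤ C`, as a presheaf on `D`; presheaves are regarded
as sheaves for the trivial topology `⊥`. -/
def restrictSheaf {T : Type*} [Category* T] (F : Sheaf J T) :
    Sheaf (⊥ : GrothendieckTopology D) T :=
  ⟨j.op ⋙ F.obj, Presheaf.isSheaf_bot _⟩

/-- The restriction of a bimodule. -/
def Bimod.restrict (M : Bimod A) : Bimod (restrictSheaf j A) where
  sh := restrictSheaf j M.sh
  lsmul U := M.lsmul (j.op.obj U)
  rsmul U := M.rsmul (j.op.obj U)
  comm U := M.comm (j.op.obj U)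
  map_lsmul f := M.map_lsmul (j.op.map f)
  map_rsmul f := M.map_rsmul (j.op.map f)

/-- The restriction of an extension `0 → M → B → A → 0` whose sections over all objects of `D`
form exact sequences. -/
def Extension.restrict {M : Bimod A} (E : Extension A M)
    (h : ∀ U : D, Function.Surjective (E.proj.app (op (j.obj U)))) :
    Extension (restrictSheaf j A) (M.restrict j) where
  B := restrictSheaf j E.B
  proj := Functor.whiskerLeft j.op E.proj
  incl U := E.incl (j.op.obj U)
  incl_naturality f := E.incl_naturality (j.op.map f)
  incl_injective U := E.incl_injective (j.op.obj U)
  proj_eq_zero_iff U := E.proj_eq_zero_iff (j.op.obj U)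
  proj_surjective := Presheaf.isLocallySurjective_of_surjective _ _ fun U => h U.unop
  mul_incl U := E.mul_incl (j.op.obj U)
  incl_mul U := E.incl_mul (j.op.obj U)

/-- The restriction of a deformation. -/
def Deformation.restrict (E : Deformation A)
    (h : ∀ U : D, Function.Surjective (E.proj.app (op (j.obj U)))) :
    Deformation (restrictSheaf j A) where
  B := restrictSheaf j E.B
  proj := Functor.whiskerLeft j.op E.proj
  incl U := E.incl (j.op.obj U)
  incl_naturality f := E.incl_naturality (j.op.map f)
  incl_injective U := E.incl_injective (j.op.obj U)
  proj_eq_zero_iff U := E.proj_eq_zero_iff (j.op.obj U)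
  proj_surjective := Presheaf.isLocallySurjective_of_surjective _ _ fun U => h U.unop
  eps_smul U := E.eps_smul (j.op.obj U)

end Restrict

/-! ### Quasicoherent sheaves of algebras on schemes -/

section Scheme
open AlgebraicGeometry
variable {X : Scheme.{u}}

/-- The inclusion of the partially ordered set of affine open subsets of `X` in that of all
open subsets. -/
abbrev affineInclusion (X : Scheme.{u}) : X.affineOpens ⥤ X.Opens :=
  Monotone.functor (f := fun U : X.affineOpens => (U : X.Opens)) (fun _ _ h => h)

/-- A homomorphism of sheaves of unital `k`-algebras `𝒪_X → A`, where `X` is a scheme over `k` with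
structure morphism `f`; the image of `𝒪_X` need not lie in the centre of `A`. By `unit_scalar` it is
compatible with the `k`-algebra structure that `f` gives to the sections of `𝒪_X`. -/
structure OAlgebra (f : X ⟶ Spec (.of k))
    (A : Sheaf (Opens.grothendieckTopology X) (AlgCat.{u} k)) where
  unit : ∀ U : X.Opensᵒᵖ, X.presheaf.obj U →+* A.obj.obj U
  unit_naturality : ∀ {U V : X.Opensᵒᵖ} (i : U ⟶ V) (x : X.presheaf.obj U),
    unit V (X.presheaf.map i x) = A.obj.map i (unit U x)
  unit_scalar : ∀ (U : X.Opensᵒᵖ) (c : k),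
    unit U (f.appLE ⊤ U.unop le_top ((Scheme.ΓSpecIso (.of k)).inv c)) =
      algebraMap k (A.obj.obj U) c

variable {f : X ⟶ Spec (.of k)} {A : Sheaf (Opens.grothendieckTopology X) (AlgCat.{u} k)}

/-- The `𝒪_X`-module obtained from the left action of `A` on a bimodule along `𝒪_X → A`. -/
def OAlgebra.leftModule (u : OAlgebra f A) (M : Bimod A) : X.Modules :=
  letI (U : X.Opensᵒᵖ) : Module (X.ringCatSheaf.obj.obj U)
      ((M.sh.obj ⋙ forget₂ (ModuleCat.{u} k) Ab.{u}).obj U) :=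
    Module.compHom (M.sh.obj.obj U)
      (((M.lsmul U).toRingHom.comp (u.unit U) : X.presheaf.obj U →+* _))
  { val := PresheafOfModules.ofPresheaf (R := X.ringCatSheaf.obj)
      (M.sh.obj ⋙ forget₂ (ModuleCat.{u} k) Ab.{u}) (by
        intro U V i r m
        exact (M.map_lsmul i (u.unit U r) m).trans
          (congrArg (fun z => M.lsmul V z (M.sh.obj.map i m)) (u.unit_naturality i r).symm))
    isSheaf := ((sheafCompose _ (forget₂ (ModuleCat.{u} k) Ab.{u})).obj M.sh).property }

/-- A quasicoherent sheaf of algebras on a scheme `X` over `k`: a sheaf of `k`-algebras `A` with a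
homomorphism of sheaves of `k`-algebras `𝒪_X → A` that makes `A` a quasicoherent left
`𝒪_X`-module. -/
structure QcohAlgebra (f : X ⟶ Spec (.of k)) where
  sh : Sheaf (Opens.grothendieckTopology X) (AlgCat.{u} k)
  toOAlgebra : OAlgebra f sh
  isQuasicoherent : (toOAlgebra.leftModule (Bimod.self sh)).IsQuasicoherent

end Scheme
end AlgExt
end

open AlgebraicGeometry AlgExt

/-! The proof has two independent parts.

The comparison of extensions on a site `C` with those on a full subcategory `D` that is dense in it
is formal once every extension of `A` by `M` on `C` is surjective on sections over the objects of
`D`. Restriction is then defined, and it is linear because it carries the fibre product maps and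
pushout maps that characterize sums and multiples to maps of the same kind. It is injective because
morphisms of sheaves are determined by, and can be constructed from, their restrictions to `D`
(`Extension.Equivalent.of_restrict`). It is surjective because an extension `0 → M → B → A → 0` of
presheaves on `D`, which is exact on all sections, has a sheaf in the middle if `A` and `M` are
sheaves (`Extension.isSheaf_of_restrict`), so that `B` extends to a sheaf on `C`; see
`Extension.exists_restrict_equivalent`. Deformations of `A` are extensions of `A` by `A`, and this
identification is compatible with restriction.

The affine open subsets of a scheme `X` form a basis, so they are dense in the site of `X`. The
surjectivity of `B(U) → A(U)` for affine `U` is the vanishing of the first cohomology of the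
quasicoherent module `M` on `U`. It is proved with Čech cocycles for finite coverings by basic open
subsets (`Scheme.Modules.exists_eq_res_sub_res`), since a section of `A` over `U` lifts to `B`
locally and the differences of the lifts form a cocycle with values in `M`
(`Extension.proj_surjective_of_isAffineOpen`). The extension `B` itself need not be an
`𝒪_X`-module, only its kernel `M` is one. -/

noncomputable section

namespace AlgExt

/-! ### Restriction of extensions is linear -/

variable {k : Type u} [Field k] {C : Type u} [SmallCategory C] {J : GrothendieckTopology C}
  {D : Type u} [SmallCategory D] (j : D ⥤ C)

section Restriction
variable {A : Sheaf J (AlgCat.{u} k)} {M : Bimod A}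

namespace Extension
variable {j}

lemma Equivalent.restrict {E E' : Extension A M} (e : Equivalent E E')
    (h : ∀ U : D, Function.Surjective (E.proj.app (op (j.obj U))))
    (h' : ∀ U : D, Function.Surjective (E'.proj.app (op (j.obj U)))) :
    Equivalent (E.restrict j h) (E'.restrict j h') := by
  obtain ⟨α, a, a'⟩ := e
  exact ⟨Functor.isoWhiskerLeft j.op α, congrArg (Functor.whiskerLeft j.op) a,
    fun U m => a' (j.op.obj U) m⟩

lemma IsSum.restrict {E₁ E₂ E₃ : Extension A M} (e : IsSum E₁ E₂ E₃)
    (h₁ : ∀ U : D, Function.Surjective (E₁.proj.app (op (j.obj U))))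
    (h₂ : ∀ U : D, Function.Surjective (E₂.proj.app (op (j.obj U))))
    (h₃ : ∀ U : D, Function.Surjective (E₃.proj.app (op (j.obj U)))) :
    IsSum (E₁.restrict j h₁) (E₂.restrict j h₂) (E₃.restrict j h₃) := by
  obtain ⟨ψ, a, a'⟩ := e
  exact ⟨Functor.whiskerLeft j.op ψ, fun U p => a (j.op.obj U) p,
    fun U m n => a' (j.op.obj U) m n⟩

lemma IsSMul.restrict {c : k} {E E' : Extension A M} (e : IsSMul c E E')
    (h : ∀ U : D, Function.Surjective (E.proj.app (op (j.obj U))))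
    (h' : ∀ U : D, Function.Surjective (E'.proj.app (op (j.obj U)))) :
    IsSMul c (E.restrict j h) (E'.restrict j h') := by
  obtain ⟨φ, a, a'⟩ := e
  exact ⟨Functor.whiskerLeft j.op φ, fun U p => a (j.op.obj U) p,
    fun U m => a' (j.op.obj U) m⟩

/-- For the trivial topology, local surjectivity is surjectivity on all sections. -/
lemma surjective_of_bot {A : Sheaf (⊥ : GrothendieckTopology D) (AlgCat.{u} k)} {M : Bimod A}
    (F : Extension A M) (U : Dᵒᵖ) : Function.Surjective (F.proj.app U) := by
  intro a
  have h := F.proj_surjective.imageSieve_mem (U := U.unop) a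
  rw [GrothendieckTopology.bot_covering] at h
  have h1 : (Presheaf.imageSieve F.proj (U := U.unop) a) (𝟙 _) := by rw [h]; trivial
  obtain ⟨b, hb⟩ := h1
  exact ⟨b, hb.trans congr($(A.obj.map_id U) a)⟩

end Extension

variable (A M) in
/-- Restriction of extensions along `j` as a `k`-linear map on `exal`, when every extension of `A`
by `M` is surjective on sections over the objects of `D`. -/
def Exal.restrict (h : ∀ (E : Extension A M) (U : D),
    Function.Surjective (E.proj.app (op (j.obj U)))) :
    Exal A M →ₗ[k] Exal (restrictSheaf j A) (M.restrict j) where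
  toFun := Quotient.map (fun E => E.restrict j (h E)) fun E E' e => e.restrict (h E) (h E')
  map_add' x y := by
    obtain ⟨E, rfl⟩ := Quotient.exists_rep x
    obtain ⟨E', rfl⟩ := Quotient.exists_rep y
    exact Exal.mk_eq.2 (((Extension.isSum_sum E E').restrict (h _) (h _) (h _)).equivalent
      (Extension.isSum_sum _ _))
  map_smul' c x := by
    obtain ⟨E, rfl⟩ := Quotient.exists_rep x
    exact Exal.mk_eq.2 (((Extension.isSMul_smul c E).restrict (h _) (h _)).equivalent
      (Extension.isSMul_smul c _))

/-- The middle term of an extension of presheaves on `D` is a sheaf for the induced topology: a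
compatible family can be glued in `A`, the result lifted to `B`, and the lift corrected by a section
glued in `M`. -/
lemma Extension.isSheaf_of_restrict (F : Extension (restrictSheaf j A) (M.restrict j)) :
    Presheaf.IsSheaf (j.inducedTopology J) F.B.obj := by
  have hsurj (U : D) : Function.Surjective (F.proj.app (op U)) := F.surjective_of_bot (op U)
  have hA : Presieve.IsSheaf (j.inducedTopology J)
      ((restrictSheaf j A).obj ⋙ forget (AlgCat.{u} k)) :=
    (isSheaf_iff_isSheaf_of_type _ _).1 (j.op_comp_isSheaf (j.inducedTopology J) J
    ((sheafCompose J (forget (AlgCat.{u} k))).obj A))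
  have hM : Presieve.IsSheaf (j.inducedTopology J)
      ((M.restrict j).sh.obj ⋙ forget (ModuleCat.{u} k)) :=
    (isSheaf_iff_isSheaf_of_type _ _).1 (j.op_comp_isSheaf (j.inducedTopology J) J
    ((sheafCompose J (forget (ModuleCat.{u} k))).obj M.sh))
  rw [Presheaf.isSheaf_iff_isSheaf_forget _ _ (forget (AlgCat.{u} k)),
    isSheaf_iff_isSheaf_of_type]
  intro U S hS
  have hsep (b b' : F.B.obj.obj (op U))
      (hb : ∀ ⦃V⦄ (f : V ⟶ U), S f → F.B.obj.map f.op b = F.B.obj.map f.op b') : b = b' := by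
    have h0 : F.proj.app (op U) b = F.proj.app (op U) b' := by
      refine (hA.isSeparated S hS).ext fun V f hf => ?_
      refine (map_apply F.proj f.op b).symm.trans (Eq.trans ?_ (map_apply F.proj f.op b'))
      rw [hb f hf]
    obtain ⟨m, rfl⟩ := F.exists_of_proj_eq h0
    have : m = 0 := by
      refine (hM.isSeparated S hS).ext fun V f hf => F.incl_injective (op V) ?_
      have h1 := hb f hf
      rw [map_add, left_eq_add, ← F.incl_naturality] at h1
      refine h1.trans ?_
      exact ((congrArg _ (map_zero ((M.restrict j).sh.obj.map f.op).hom)).trans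
        (map_zero (F.incl (op V)))).symm
    rw [this, map_zero, add_zero]
  intro x hx
  obtain ⟨a, ha, -⟩ := hA S hS (fun V f hf => F.proj.app (op V) (x f hf)) (by
    intro V₁ V₂ W g₁ g₂ f₁ f₂ h₁ h₂ e
    refine (map_apply F.proj g₁.op _).symm.trans (Eq.trans ?_ (map_apply F.proj g₂.op _))
    exact congrArg _ (hx g₁ g₂ h₁ h₂ e))
  obtain ⟨b, rfl⟩ := hsurj U a
  have hm ⦃V⦄ (f : V ⟶ U) (hf : S f) :
      ∃ m, x f hf = F.B.obj.map f.op b + F.incl (op V) m :=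
    F.exists_of_proj_eq ((map_apply F.proj f.op b).trans (ha f hf))
  choose m hm using hm
  obtain ⟨t, ht, -⟩ := hM S hS m (by
    intro V₁ V₂ W g₁ g₂ f₁ f₂ h₁ h₂ e
    apply F.incl_injective
    refine (F.incl_naturality g₁.op _).trans (Eq.trans ?_ (F.incl_naturality g₂.op _).symm)
    have := hx g₁ g₂ h₁ h₂ e
    change F.B.obj.map g₁.op _ = F.B.obj.map g₂.op _ at this
    rw [hm, hm, map_add, map_add, ← ConcreteCategory.comp_apply, ← ConcreteCategory.comp_apply,
      ← Functor.map_comp, ← Functor.map_comp, ← op_comp, ← op_comp, e] at this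
    exact add_left_cancel this)
  have hglue : ∀ ⦃V⦄ (f : V ⟶ U) (hf : S f),
      F.B.obj.map f.op (b + F.incl (op U) t) = x f hf := fun V f hf => by
    rw [map_add, ← F.incl_naturality, hm]
    exact congrArg (fun z => _ + F.incl (op V) z) (ht f hf)
  exact ⟨b + F.incl (op U) t, hglue,
    fun y hy => hsep _ _ fun V f hf => (hy f hf).trans (hglue f hf).symm⟩

end Restriction

/-! ### Extensions on a dense subcategory -/

section DenseSubsite
variable {A : Sheaf J (AlgCat.{u} k)} {M : Bimod A} [j.IsCoverDense J]

/-- Sections of a sheaf of algebras are determined by their restrictions to the objects of a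
cover dense subcategory. -/
lemma alg_ext_of_isCoverDense (F : Sheaf J (AlgCat.{u} k)) {U : C} (x y : F.obj.obj (op U))
    (h : ∀ (V : D) (f : j.obj V ⟶ U), F.obj.map f.op x = F.obj.map f.op y) : x = y := by
  refine Extension.alg_ext F (U := op U) _ (j.is_cover_of_isCoverDense J U) x y ?_
  rintro V _ ⟨⟨W, a, b, rfl⟩⟩
  rw [op_comp, Functor.map_comp, ConcreteCategory.comp_apply, ConcreteCategory.comp_apply, h]

lemma mod_ext_of_isCoverDense (F : Sheaf J (ModuleCat.{u} k)) {U : C} (x y : F.obj.obj (op U))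
    (h : ∀ (V : D) (f : j.obj V ⟶ U), F.obj.map f.op x = F.obj.map f.op y) : x = y := by
  refine Extension.mod_ext F (U := op U) _ (j.is_cover_of_isCoverDense J U) x y ?_
  rintro V _ ⟨⟨W, a, b, rfl⟩⟩
  rw [op_comp, Functor.map_comp, ConcreteCategory.comp_apply, ConcreteCategory.comp_apply, h]

variable [j.Full]

/-- An isomorphism of the restrictions to a dense subcategory extends, as morphisms into a sheaf are
determined there, and is compatible with the projections and inclusions because it is so locally. -/
lemma Extension.Equivalent.of_restrict {E E' : Extension A M}
    (h : ∀ U : D, Function.Surjective (E.proj.app (op (j.obj U))))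
    (h' : ∀ U : D, Function.Surjective (E'.proj.app (op (j.obj U))))
    (e : Equivalent (E.restrict j h) (E'.restrict j h')) : Equivalent E E' := by
  obtain ⟨α, a, a'⟩ := e
  let β : E.B.obj ⟶ E'.B.obj := Functor.IsCoverDense.sheafHom (G := j) (K := J) α.hom
  have hβ (V : D) : β.app (op (j.obj V)) = α.hom.app (op V) :=
    congr($(Functor.IsCoverDense.sheafHom_restrict_eq (G := j) (K := J) α.hom).app (op V))
  refine equivalent_of_hom β ?_ ?_
  · ext ⟨U⟩ b
    refine alg_ext_of_isCoverDense j A _ _ fun V f => ?_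
    rw [← map_apply, ← map_apply]
    change E'.proj.app _ (β.app _ (E.B.obj.map f.op b)) = _
    rw [hβ]
    exact congr($(a).app (op V) _)
  · rintro ⟨U⟩ m
    refine alg_ext_of_isCoverDense j E'.B _ _ fun V f => ?_
    rw [← map_apply, ← E.incl_naturality, ← E'.incl_naturality, hβ]
    exact a' (op V) _

variable [j.Faithful]

/-- The existence part of the comparison lemma. -/
lemma exists_extension_of_isCoverDense {T : Type*} [Category* T]
    [∀ U : Cᵒᵖ, Limits.HasLimitsOfShape (StructuredArrow U j.op) T] (G : Dᵒᵖ ⥤ T)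
    (hG : Presheaf.IsSheaf (j.inducedTopology J) G) :
    ∃ G' : Sheaf J T, Nonempty (j.op ⋙ G'.obj ≅ G) :=
  ⟨_, ⟨(sheafToPresheaf _ _).mapIso
    ((Functor.IsDenseSubsite.sheafEquiv (j.inducedTopology J) J j T).unitIso.app ⟨G, hG⟩).symm⟩⟩

/-- Every extension of presheaves on `D` comes from an extension of sheaves on `C`: its middle term
is a sheaf for the induced topology, hence extends, and the exactness properties hold locally. -/
lemma Extension.exists_restrict_equivalent
    (h : ∀ (E : Extension A M) (U : D), Function.Surjective (E.proj.app (op (j.obj U))))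
    (F : Extension (restrictSheaf j A) (M.restrict j)) :
    ∃ E : Extension A M, Equivalent (E.restrict j (h E)) F := by
  obtain ⟨B, ⟨ε⟩⟩ := exists_extension_of_isCoverDense j F.B.obj (F.isSheaf_of_restrict j)
  -- On `D` the projection and the inclusion are those of `F`; by density they extend to `C`.
  let p : B.obj ⟶ A.obj :=
    Functor.IsCoverDense.sheafHom (G := j) (K := J) (ε.hom ≫ F.proj : j.op ⋙ B.obj ⟶ j.op ⋙ A.obj)
  have hp (V : D) (b : B.obj.obj (op (j.obj V))) :
      p.app (op (j.obj V)) b = F.proj.app (op V) (ε.hom.app (op V) b) :=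
    congr($(Functor.IsCoverDense.sheafHom_restrict_eq (G := j) (K := J)
      (ε.hom ≫ F.proj : j.op ⋙ B.obj ⟶ j.op ⋙ A.obj)).app (op V) b)
  let B' : Sheaf J (ModuleCat.{u} k) :=
    (sheafCompose J (forget₂ (AlgCat.{u} k) (ModuleCat.{u} k))).obj B
  -- The inclusion is only linear, so it is extended as a morphism of sheaves of modules.
  let i₀ : j.op ⋙ M.sh.obj ⟶ j.op ⋙ B'.obj :=
    { app := fun V => ModuleCat.ofHom ((ε.inv.app V).hom.toLinearMap ∘ₗ F.incl V)
      naturality := fun V W f => by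
        refine ModuleCat.hom_ext (LinearMap.ext fun m => ?_)
        exact (congrArg (ε.inv.app W) (F.incl_naturality f m)).trans (map_apply ε.inv f _) }
  let i : M.sh.obj ⟶ B'.obj := Functor.IsCoverDense.sheafHom (G := j) (K := J) i₀
  let incl (U : Cᵒᵖ) : M.sh.obj.obj U →ₗ[k] B.obj.obj U := (i.app U).hom
  have hi (V : D) (m : M.sh.obj.obj (op (j.obj V))) :
      incl (op (j.obj V)) m = ε.inv.app (op V) (F.incl (op V) m) :=
    congr($(Functor.IsCoverDense.sheafHom_restrict_eq (G := j) (K := J) i₀).app (op V) m)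
  have nat {U V : Cᵒᵖ} (f : U ⟶ V) (m : M.sh.obj.obj U) :
      incl V (M.sh.obj.map f m) = B.obj.map f (incl U m) := NatTrans.naturality_apply i f m
  have hε (V : D) (b : B.obj.obj (op (j.obj V))) : ε.inv.app (op V) (ε.hom.app (op V) b) = b :=
    congr($(ε.hom_inv_id).app (op V) b)
  have hε' (V : D) (b : F.B.obj.obj (op V)) : ε.hom.app (op V) (ε.inv.app (op V) b) = b :=
    congr($(ε.inv_hom_id).app (op V) b)
  have inj (U : Cᵒᵖ) : Function.Injective (incl U) := by
    intro m n e
    refine mod_ext_of_isCoverDense j M.sh (U := U.unop) m n fun V f => ?_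
    have e' := congrArg (B.obj.map f.op) e
    rw [← nat, ← nat, hi, hi] at e'
    exact F.incl_injective _ (by simpa only [hε'] using congrArg (ε.hom.app (op V)) e')
  have pi (U : Cᵒᵖ) (m : M.sh.obj.obj U) : p.app U (incl U m) = 0 := by
    refine alg_ext_of_isCoverDense j A (U := U.unop) _ _ fun V f => ?_
    rw [← map_apply, ← nat, hp, hi, hε', map_zero]
    exact F.proj_incl (op V) _
  let E : Extension A M :=
    { B := B
      proj := p
      incl := incl
      incl_naturality := nat
      incl_injective := inj
      proj_eq_zero_iff := fun U b => by
        refine ⟨fun hb => ?_, ?_⟩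
        · refine exists_glue M.sh B incl nat inj _ (j.is_cover_of_isCoverDense J U.unop) b ?_
          rintro V _ ⟨⟨W, f, g, rfl⟩⟩
          obtain ⟨m, hm⟩ := (F.proj_eq_zero_iff (op W) (ε.hom.app (op W) (B.obj.map g.op b))).1 (by
            rw [← hp, map_apply, hb, map_zero]; rfl)
          have hm' : incl (op (j.obj W)) m = B.obj.map g.op b := by
            refine (hi W m).trans ?_
            rw [hm, hε]
          refine ⟨M.sh.obj.map f.op m, (nat f.op _).trans ?_⟩
          rw [hm', op_comp, Functor.map_comp, ConcreteCategory.comp_apply]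
        · rintro ⟨m, rfl⟩
          exact pi U m
      proj_surjective := by
        constructor
        intro U a
        refine J.superset_covering ?_ (j.is_cover_of_isCoverDense J U)
        rintro V _ ⟨⟨W, f, g, rfl⟩⟩
        obtain ⟨b, hb⟩ := F.surjective_of_bot (op W) (A.obj.map g.op a)
        refine ⟨B.obj.map f.op (ε.inv.app (op W) b), ?_⟩
        rw [map_apply, hp, hε', hb, op_comp, Functor.map_comp, ConcreteCategory.comp_apply]
      mul_incl := fun U b m => by
        refine alg_ext_of_isCoverDense j B (U := U.unop) _ _ fun V f => ?_
        rw [map_mul, ← nat, ← nat, M.map_lsmul, ← map_apply, hi, hi, hp]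
        refine Eq.trans ?_ (congrArg (ε.inv.app (op V))
          (F.mul_incl (op V) (ε.hom.app (op V) (B.obj.map f.op b)) _))
        rw [map_mul, hε]
      incl_mul := fun U b m => by
        refine alg_ext_of_isCoverDense j B (U := U.unop) _ _ fun V f => ?_
        rw [map_mul, ← nat, ← nat, M.map_rsmul, ← map_apply, hi, hi, hp]
        refine Eq.trans ?_ (congrArg (ε.inv.app (op V))
          (F.incl_mul (op V) (ε.hom.app (op V) (B.obj.map f.op b)) _))
        rw [map_mul, hε] }
  refine ⟨E, equivalent_of_hom ε.hom ?_ ?_⟩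
  · ext V b
    exact (hp V.unop b).symm
  · rintro ⟨V⟩ m
    exact (congrArg _ (hi V m)).trans (hε' V _)

variable (A M) in
/-- If `D` is dense in `C` and every extension of `A` by `M` is surjective on sections over the
objects of `D`, then restriction to `D` is an isomorphism. -/
lemma Exal.restrict_bijective (h : ∀ (E : Extension A M) (U : D),
    Function.Surjective (E.proj.app (op (j.obj U)))) :
    Function.Bijective (Exal.restrict j A M h) := by
  constructor
  · intro x y e
    obtain ⟨E, rfl⟩ := Quotient.exists_rep x
    obtain ⟨E', rfl⟩ := Quotient.exists_rep y
    exact Exal.mk_eq.2 (.of_restrict j (h E) (h E') (Exal.mk_eq.1 e))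
  · intro y
    obtain ⟨F, rfl⟩ := Quotient.exists_rep y
    obtain ⟨E, e⟩ := Extension.exists_restrict_equivalent j h F
    exact ⟨Exal.mk E, Exal.mk_eq.2 e⟩

/-- The identification of `def(A)` with `exal(A, A)` is linear, by the definition of the vector
space structure on `def(A)`. -/
def Def.linearEquivExal {C : Type u} [SmallCategory C] {J : GrothendieckTopology C}
    (A : Sheaf J (AlgCat.{u} k)) : Def A ≃ₗ[k] Exal A (Bimod.self A) :=
  { Def.equivExal A with
    map_add' := fun _ _ => (Def.equivExal A).apply_symm_apply _
    map_smul' := fun _ _ => (Def.equivExal A).apply_symm_apply _ }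

theorem Exal.exists_linearEquiv_restrict (h : ∀ (E : Extension A M) (U : D),
    Function.Surjective (E.proj.app (op (j.obj U)))) :
    ∃ e : Exal A M ≃ₗ[k] Exal (restrictSheaf j A) (M.restrict j),
      ∀ E : Extension A M, e (Exal.mk E) = Exal.mk (E.restrict j (h E)) :=
  ⟨LinearEquiv.ofBijective _ (Exal.restrict_bijective j A M h), fun _ => rfl⟩

theorem Def.exists_linearEquiv_restrict (h : ∀ (E : Extension A (Bimod.self A)) (U : D),
    Function.Surjective (E.proj.app (op (j.obj U)))) :
    ∃ e : Def A ≃ₗ[k] Def (restrictSheaf j A),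
      ∀ E : Deformation A, e (Def.mk E) = Def.mk (E.restrict j (h E.toExtension)) := by
  refine ⟨(Def.linearEquivExal A).trans ((LinearEquiv.ofBijective _
    (Exal.restrict_bijective j A (Bimod.self A) h)).trans
      (Def.linearEquivExal (restrictSheaf j A)).symm), fun E => ?_⟩
  -- The restriction of `A` as a bimodule over itself is, by definition, that of the restriction.
  exact (Def.linearEquivExal (restrictSheaf j A)).symm_apply_apply
    (Def.mk (E.restrict j (h E.toExtension)))

end DenseSubsite

end AlgExt
end

noncomputable section

/-! ### Čech cohomology of quasicoherent modules on affine schemes -/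

namespace AlgebraicGeometry

/-- The basic open subset `D(f)`, as an open subset of the scheme `Spec R` rather than of the
topological space `PrimeSpectrum R`. -/
def specD {R : CommRingCat.{u}} (f : R) : (Spec R).Opens := PrimeSpectrum.basicOpen f

lemma specD_mul {R : CommRingCat.{u}} (f g : R) : specD (f * g) = specD f ⊓ specD g :=
  PrimeSpectrum.basicOpen_mul f g

namespace Scheme.Modules

/-- The restriction of a section to a smaller open set. -/
def res {X : Scheme.{u}} (M : X.Modules) {U V : X.Opens} (h : V ≤ U) : Γ(M, U) →+ Γ(M, V) :=
  (M.presheaf.map (homOfLE h).op).hom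

lemma res_res {X : Scheme.{u}} (M : X.Modules) {U V W : X.Opens} (h : V ≤ U) (h' : W ≤ V)
    (s : Γ(M, U)) : M.res h' (M.res h s) = M.res (h'.trans h) s :=
  congr($(M.presheaf.map_comp (homOfLE h).op (homOfLE h').op) s).symm

variable {R : CommRingCat.{u}} (M : (Spec R).Modules)

lemma res_smul {U V : (Spec R).Opens} (h : V ≤ U) (r : R) (s : Γ(M, U)) :
    M.res h (r • s) = r • M.res h s := map_smul_Spec _ _ _

lemma isSMulRegular_of_le_specD {f : R} {U : (Spec R).Opens} (h : U ≤ specD f) :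
    IsSMulRegular Γ(M, U) f := M.isSMulRegular_of_le_basicOpen h

lemma exists_pow_smul_eq_of_le_specD {f : R} {U : (Spec R).Opens} (h : U ≤ specD f) (n : ℕ)
    (s : Γ(M, U)) : ∃ t : Γ(M, U), f ^ n • t = s := by
  obtain ⟨t, ht⟩ := ((Module.End.isUnit_iff _).1
    ((M.isUnit_algebraMap_end_of_le_basicOpen f h).pow n)).2 s
  rw [← map_pow, Module.algebraMap_end_apply] at ht
  exact ⟨t, ht⟩

variable [M.IsQuasicoherent]

lemma isLocalizing_of_isQuasicoherent : IsLocalizing (modulesSpecToSheaf.obj M) :=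
  (isIso_fromTildeΓ_iff_isLocalizing M).1 inferInstance

/-- Up to a power of `f`, sections over `D(f)` extend to `Spec R`. -/
lemma exists_res_top_eq (f : R) (s : Γ(M, specD f)) :
    ∃ (n : ℕ) (t : Γ(M, ⊤)), M.res le_top t = f ^ n • s := by
  obtain ⟨⟨t, ⟨_, n, rfl⟩⟩, h⟩ := (M.isLocalizing_of_isQuasicoherent f).surj s
  exact ⟨n, t, h.symm⟩

lemma exists_pow_smul_eq_zero_of_res_top (f : R) (t : Γ(M, ⊤))
    (h : M.res (V := specD f) le_top t = 0) :
    ∃ n : ℕ, f ^ n • t = 0 := by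
  have := (M.isLocalizing_of_isQuasicoherent f).exists_of_eq (x₁ := t) (x₂ := 0)
    (h.trans (map_zero _).symm)
  obtain ⟨⟨_, n, rfl⟩, h⟩ := this
  exact ⟨n, h.trans (smul_zero _)⟩

/-- Up to a power of `f`, sections over `D(f) ∩ D(g)` extend to `D(g)`. -/
lemma exists_res_eq_pow_smul (f g : R) {W : (Spec R).Opens}
    (hW : W = specD f ⊓ specD g) (s : Γ(M, W)) :
    ∃ (n : ℕ) (t : Γ(M, specD g)),
      M.res (hW.trans_le inf_le_right) t = f ^ n • s := by
  rw [← specD_mul] at hW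
  subst hW
  obtain ⟨n, t, ht⟩ := M.exists_res_top_eq _ s
  obtain ⟨t', ht'⟩ := M.exists_pow_smul_eq_of_le_specD (le_refl (specD g)) n (M.res le_top t)
  refine ⟨n, t', ((M.isSMulRegular_of_le_specD
    ((specD_mul f g).trans_le inf_le_right)).pow n) ?_⟩
  dsimp only
  rw [← res_smul, ht', res_res, ht, mul_pow, mul_smul, smul_comm]

/-- A section over `D(g)` that vanishes on `D(f) ∩ D(g)` is killed by a power of `f`. -/
lemma exists_pow_smul_eq_zero (f g : R) {V W : (Spec R).Opens} (hV : V = specD g)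
    (hW : W = specD f ⊓ V) (s : Γ(M, V)) (h : M.res (hW.trans_le inf_le_right) s = 0) :
    ∃ n : ℕ, f ^ n • s = 0 := by
  subst hV
  rw [← specD_mul] at hW
  subst hW
  obtain ⟨n, t, ht⟩ := M.exists_res_top_eq _ s
  obtain ⟨m, hm⟩ := M.exists_pow_smul_eq_zero_of_res_top (f * g) t (by
    rw [← M.res_res (le_top (a := specD g))
      ((specD_mul f g).trans_le inf_le_right), ht, res_smul, h, smul_zero])
  refine ⟨m, ((M.isSMulRegular_of_le_specD (le_refl (specD g))).pow (m + n)) ?_⟩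
  dsimp only
  rw [smul_zero, smul_comm, pow_add, mul_smul, ← ht, ← res_smul, ← res_smul, ← mul_smul, ← mul_pow,
    hm, map_zero]

/-- The first Čech cohomology of a quasicoherent module on an affine scheme vanishes, for a finite
covering by basic open subsets: a cocycle `c` is a coboundary. -/
theorem exists_eq_res_sub_res {ι : Type*} [Finite ι] (g : ι → R)
    (hg : Ideal.span (Set.range g) = ⊤)
    (c : ∀ i j, Γ(M, specD (g i) ⊓ specD (g j)))
    (hc : ∀ i j l (W : (Spec R).Opens)
      (hij : W ≤ specD (g i) ⊓ specD (g j))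
      (hjl : W ≤ specD (g j) ⊓ specD (g l))
      (hil : W ≤ specD (g i) ⊓ specD (g l)),
      M.res hij (c i j) + M.res hjl (c j l) = M.res hil (c i l)) :
    ∃ n : ∀ i, Γ(M, specD (g i)),
      ∀ i j, c i j = M.res inf_le_right (n j) - M.res inf_le_left (n i) := by
  cases nonempty_fintype ι
  -- Let `tᵢⱼ` over `D(gⱼ)` extend `gᵢ ^ N • cᵢⱼ`. By the cocycle condition
  -- `gᵢ ^ K • (tᵢₗ - tᵢⱼ) = gᵢ ^ (K + N) • cⱼₗ` for large `K`. If `∑ aᵢ * gᵢ ^ (K + N) = 1`, then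
  -- `c` is the coboundary of `∑ aᵢ * gᵢ ^ K • tᵢⱼ`.
  choose N₀ t₀ ht₀ using fun i j => M.exists_res_eq_pow_smul (g i) (g j) rfl (c i j)
  obtain ⟨N, hN⟩ : ∃ N, ∀ i j, N₀ i j ≤ N :=
    ⟨∑ p : ι × ι, N₀ p.1 p.2, fun i j => Finset.single_le_sum
      (f := fun p : ι × ι => N₀ p.1 p.2) (fun _ _ => Nat.zero_le _) (Finset.mem_univ (i, j))⟩
  obtain ⟨t, ht⟩ : ∃ t : ∀ _ j, Γ(M, specD (g j)),
      ∀ i j, M.res inf_le_right (t i j) = g i ^ N • c i j :=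
    ⟨fun i j => g i ^ (N - N₀ i j) • t₀ i j, fun i j => by
      rw [res_smul, ht₀, ← mul_smul, ← pow_add, Nat.sub_add_cancel (hN i j)]⟩
  have hd i j l : ∃ n : ℕ, g i ^ n • (M.res inf_le_right (t i l) - M.res inf_le_left (t i j)
      - g i ^ N • c j l) = 0 := by
    refine M.exists_pow_smul_eq_zero (g i) (g j * g l) (specD_mul _ _).symm rfl _ ?_
    rw [map_sub, map_sub, res_smul, res_res, res_res,
      ← M.res_res (inf_le_right (a := specD (g i))) (le_inf inf_le_left
        (inf_le_right.trans inf_le_right)) (t i l),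
      ← M.res_res (inf_le_right (a := specD (g i))) (le_inf inf_le_left
        (inf_le_right.trans inf_le_left)) (t i j), ht, ht, res_smul, res_smul, ← smul_sub,
      ← smul_sub, ← hc i j l _ (le_inf inf_le_left (inf_le_right.trans inf_le_left)) inf_le_right,
      add_sub_cancel_left, sub_self, smul_zero]
  choose K₀ hK₀ using hd
  obtain ⟨K, hK⟩ : ∃ K, ∀ i j l, K₀ i j l ≤ K :=
    ⟨∑ p : ι × ι × ι, K₀ p.1 p.2.1 p.2.2, fun i j l => Finset.single_le_sum
      (f := fun p : ι × ι × ι => K₀ p.1 p.2.1 p.2.2) (fun _ _ => Nat.zero_le _)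
      (Finset.mem_univ (i, j, l))⟩
  have hd i j l : g i ^ K • (M.res inf_le_right (t i l) - M.res inf_le_left (t i j)) =
      g i ^ (K + N) • c j l := by
    rw [pow_add, mul_smul, ← sub_eq_zero, ← smul_sub, ← Nat.sub_add_cancel (hK i j l), pow_add,
      mul_smul, hK₀, smul_zero]
  obtain ⟨a, ha⟩ : ∃ a : ι → R, ∑ i, a i * g i ^ (K + N) = 1 := by
    rw [← Ideal.mem_span_range_iff_exists_fun]
    have := Ideal.span_pow_eq_top _ hg (K + N)
    rw [← Set.range_comp] at this
    exact this ▸ Submodule.mem_top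
  refine ⟨fun j => ∑ i, (a i * g i ^ K) • t i j, fun j l => ?_⟩
  rw [map_sum, map_sum, ← Finset.sum_sub_distrib]
  conv_lhs => rw [← one_smul R (c j l), ← ha, Finset.sum_smul]
  refine Finset.sum_congr rfl fun i _ => ?_
  rw [res_smul, res_smul, ← smul_sub, mul_smul, mul_smul, hd]

end Scheme.Modules

end AlgebraicGeometry

end

noncomputable section

/-! ### Surjectivity on sections over affine open sets -/

namespace AlgExt
open AlgebraicGeometry.Scheme.Modules

variable {k : Type u} [Field k] {X : Scheme.{u}} {f : X ⟶ Spec (.of k)}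
  {A : Sheaf (Opens.grothendieckTopology X) (AlgCat.{u} k)}

/-- The restriction of a section of a presheaf of algebras to a smaller open set. -/
def algRes (F : X.Opensᵒᵖ ⥤ AlgCat.{u} k) {U V : X.Opens} (h : V ≤ U) :
    F.obj (op U) →ₐ[k] F.obj (op V) :=
  (F.map (homOfLE h).op).hom

lemma algRes_algRes (F : X.Opensᵒᵖ ⥤ AlgCat.{u} k) {U V W : X.Opens} (h : V ≤ U) (h' : W ≤ V)
    (x : F.obj (op U)) : algRes F h' (algRes F h x) = algRes F (h'.trans h) x :=
  congr($(F.map_comp (homOfLE h).op (homOfLE h').op) x).symm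

lemma app_algRes {F G : X.Opensᵒᵖ ⥤ AlgCat.{u} k} (p : F ⟶ G) {U V : X.Opens} (h : V ≤ U)
    (x : F.obj (op U)) : p.app (op V) (algRes F h x) = algRes G h (p.app (op U) x) :=
  map_apply p _ x

instance isCoverDense_affineInclusion (X : Scheme.{u}) :
    (affineInclusion X).IsCoverDense (Opens.grothendieckTopology X) :=
  (TopCat.Opens.coverDense_iff_isBasis _).2 (by
    have : Set.range (affineInclusion X).obj = X.affineOpens := Subtype.range_coe
    rw [this]
    exact X.isBasis_affineOpens)

instance full_affineInclusion (X : Scheme.{u}) : (affineInclusion X).Full where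
  map_surjective g := ⟨homOfLE g.le, Subsingleton.elim _ _⟩

/-- A section over an affine open set that lifts locally lifts over the members of a finite
covering by basic open sets. -/
lemma Extension.exists_span_eq_top_lift {M : Bimod A} (E : Extension A M) {U : X.Opens}
    (hU : IsAffineOpen U) (hle : ∀ W, hU.fromSpec ''ᵁ W ≤ U) (a : A.obj.obj (op U)) :
    ∃ (ι : Type u) (_ : Finite ι) (g : ι → Γ(X, U)), Ideal.span (Set.range g) = ⊤ ∧
      ∀ i, ∃ b, E.proj.app (op (hU.fromSpec ''ᵁ specD (g i))) b = algRes A.obj (hle _) a := by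
  let T : Set Γ(X, U) :=
    {g | ∃ b, E.proj.app (op (hU.fromSpec ''ᵁ specD g)) b = algRes A.obj (hle _) a}
  have hT : Ideal.span T = ⊤ := by
    rw [← PrimeSpectrum.iSup_basicOpen_eq_top_iff', eq_top_iff]
    intro x _
    obtain ⟨V, i, ⟨b, hb⟩, hxV⟩ := E.proj_surjective.imageSieve_mem a (hU.fromSpec x)
      (hU.range_fromSpec.le ⟨x, rfl⟩)
    obtain ⟨_, ⟨_, ⟨g, rfl⟩, rfl⟩, hxg, hgV⟩ :=
      PrimeSpectrum.isBasis_basic_opens.exists_subset_of_mem_open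
        (show x ∈ ((hU.fromSpec ⁻¹ᵁ V : (Spec Γ(X, U)).Opens) : Set (Spec Γ(X, U))) from hxV)
        (hU.fromSpec ⁻¹ᵁ V).isOpen
    have hV : hU.fromSpec ''ᵁ specD g ≤ V :=
      (hU.fromSpec.image_mono hgV).trans (hU.fromSpec.image_preimage_le V)
    refine TopologicalSpace.Opens.mem_iSup.2 ⟨g, TopologicalSpace.Opens.mem_iSup.2
      ⟨⟨algRes E.B.obj hV b, ?_⟩, hxg⟩⟩
    rw [app_algRes]
    exact (congrArg (algRes A.obj hV) hb).trans (algRes_algRes A.obj i.le hV a)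
  obtain ⟨s, hs, hs'⟩ := (Ideal.span_eq_top_iff_finite T).1 hT
  exact ⟨s, inferInstance, fun g => g, by simpa using hs', fun g => hs g.2⟩

/-- Local lifts along `B → A` of a section over an affine open set differ by a Čech 1-cocycle with
values in the quasicoherent kernel; subtracting a cochain that bounds it makes them compatible. -/
theorem Extension.proj_surjective_of_isAffineOpen (u : OAlgebra f A) {M : Bimod A}
    (hM : (u.leftModule M).IsQuasicoherent) (E : Extension A M) {U : X.Opens}
    (hU : IsAffineOpen U) : Function.Surjective (E.proj.app (op U)) := by
  intro a
  let φ := hU.fromSpec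
  let N : (Spec Γ(X, U)).Modules := (u.leftModule M).restrict φ
  have : N.IsQuasicoherent := isQuasicoherent_restrictFunctor φ (u.leftModule M)
  -- A section of `N` over `W` is by definition a section of `M` over the image of `W` in `X`.
  let τ (W : (Spec Γ(X, U)).Opens) : Γ(N, W) →+ E.B.obj.obj (op (φ ''ᵁ W)) :=
    (E.incl (op (φ ''ᵁ W))).toAddMonoidHom
  have τ_res {W W' : (Spec Γ(X, U)).Opens} (h : W' ≤ W) (s : Γ(N, W)) :
      τ W' (N.res h s) = algRes E.B.obj (φ.image_mono h) (τ W s) :=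
    E.incl_naturality _ _
  have τ_inj (W : (Spec Γ(X, U)).Opens) : Function.Injective (τ W) := E.incl_injective _
  have proj_τ (W : (Spec Γ(X, U)).Opens) (s : Γ(N, W)) :
      E.proj.app (op (φ ''ᵁ W)) (τ W s) = 0 := E.proj_incl _ _
  have hle (W : (Spec Γ(X, U)).Opens) : φ ''ᵁ W ≤ U :=
    (φ.image_le_opensRange W).trans hU.opensRange_fromSpec.le
  obtain ⟨ι, _, g, hg, hb⟩ := E.exists_span_eq_top_lift hU hle a
  choose b hb using hb
  have hc (i j : ι) : ∃ c : Γ(N, specD (g i) ⊓ specD (g j)),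
      algRes E.B.obj (φ.image_mono inf_le_right) (b j) =
        algRes E.B.obj (φ.image_mono inf_le_left) (b i) + τ _ c :=
    E.exists_of_proj_eq (by
      rw [app_algRes, app_algRes, hb, hb, algRes_algRes, algRes_algRes])
  choose c hc using hc
  obtain ⟨n, hn⟩ := N.exists_eq_res_sub_res g hg c (by
    intro i j l W hij hjl hil
    have h1 := congrArg (algRes E.B.obj (φ.image_mono hij)) (hc i j)
    have h2 := congrArg (algRes E.B.obj (φ.image_mono hjl)) (hc j l)
    have h3 := congrArg (algRes E.B.obj (φ.image_mono hil)) (hc i l)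
    rw [map_add, algRes_algRes, algRes_algRes, ← τ_res hij] at h1
    rw [map_add, algRes_algRes, algRes_algRes, ← τ_res hjl] at h2
    rw [map_add, algRes_algRes, algRes_algRes, ← τ_res hil] at h3
    apply τ_inj
    rw [h2, h1, add_assoc] at h3
    rw [map_add]
    exact add_left_cancel h3)
  have hcov : U ≤ ⨆ i, φ ''ᵁ specD (g i) := by
    rw [← φ.image_iSup, show ⨆ i, specD (g i) = ⊤ from
      PrimeSpectrum.iSup_basicOpen_eq_top_iff.2 hg, φ.image_top_eq_opensRange]
    exact hU.opensRange_fromSpec.ge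
  have hcomp (i j : ι) : algRes E.B.obj (φ.image_mono inf_le_left) (b i - τ _ (n i)) =
      algRes E.B.obj (φ.image_mono (inf_le_right (a := specD (g i)))) (b j - τ _ (n j)) := by
    rw [map_sub, map_sub, ← τ_res inf_le_left, ← τ_res inf_le_right, hc i j, hn i j, map_sub]
    abel
  obtain ⟨y, hy, -⟩ := TopCat.Sheaf.existsUnique_gluing' (X := X.carrier) E.B
    (fun i => φ ''ᵁ specD (g i)) U (fun i => homOfLE (hle _)) hcov (fun i => b i - τ _ (n i)) (by
      intro i j
      have hinf : φ ''ᵁ specD (g i) ⊓ φ ''ᵁ specD (g j) ≤ φ ''ᵁ (specD (g i) ⊓ specD (g j)) := by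
        rintro _ ⟨⟨x, hx, rfl⟩, ⟨x', hx', e⟩⟩
        obtain rfl := φ.isOpenEmbedding.injective e
        exact ⟨x', ⟨hx, hx'⟩, rfl⟩
      have := congrArg (algRes E.B.obj hinf) (hcomp i j)
      rwa [algRes_algRes, algRes_algRes] at this)
  refine ⟨y, TopCat.Sheaf.eq_of_locally_eq' (X := X.carrier) A (fun i => φ ''ᵁ specD (g i)) U
    (fun i => homOfLE (hle _)) hcov _ _ fun i => ?_⟩
  rw [← map_apply, hy, map_sub, hb, proj_τ, sub_zero]
  rfl

end AlgExt

end

theorem lemma5p1 {k : Type u} [Field k] {X : Scheme.{u}} (f : X ⟶ Spec (.of k))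
    (A : QcohAlgebra f) (M : Bimod A.sh) (hM : (A.toOAlgebra.leftModule M).IsQuasicoherent) :
    (∃ h : ∀ (E : Extension A.sh M) (U : X.affineOpens),
        Function.Surjective (E.proj.app (op ((affineInclusion X).obj U))),
      ∃ e : Exal A.sh M ≃ₗ[k]
          Exal (restrictSheaf (affineInclusion X) A.sh) (M.restrict (affineInclusion X)),
        ∀ E : Extension A.sh M, e (Exal.mk E) = Exal.mk (E.restrict (affineInclusion X) (h E))) ∧
    (∃ h : ∀ (E : Deformation A.sh) (U : X.affineOpens),
        Function.Surjective (E.proj.app (op ((affineInclusion X).obj U))),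
      ∃ e : Def A.sh ≃ₗ[k] Def (restrictSheaf (affineInclusion X) A.sh),
        ∀ E : Deformation A.sh,
          e (Def.mk E) = Def.mk (E.restrict (affineInclusion X) (h E))) := by
  have h (M : Bimod A.sh) (hM : (A.toOAlgebra.leftModule M).IsQuasicoherent)
      (E : Extension A.sh M) (U : X.affineOpens) :
      Function.Surjective (E.proj.app (op ((affineInclusion X).obj U))) :=
    E.proj_surjective_of_isAffineOpen A.toOAlgebra hM U.2
  exact ⟨⟨h M hM, Exal.exists_linearEquiv_restrict _ (h M hM)⟩,
    ⟨fun E => h _ A.isQuasicoherent E.toExtension,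
      Def.exists_linearEquiv_restrict _ (h _ A.isQuasicoherent)⟩⟩
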